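/- **Setting.** Let $\mathcal X$ be a countable sample space, $\mathcal D$ a probability distribution on $\mathcal X$, $\mathcal Y$ a two-element label set, $f:\mathcal X\to\mathcal Y$ a labelling function, and $h_1,\dots,h_k:\mathcal X\to\mathcal Y$ hypotheses that are not all equal; put $\mathcal H=\{h_1,\dots,h_k\}$. Let $L(y',y)=\mathbf 1[y'\ne y]$ be the 0-1 loss, $\mathcal R(h)=\sum_{x\in\mathcal X}\mathcal D(x)\,L(h(x),f(x))$ the expected risk, and $VC(\mathcal H)$ the VC-dimension of $\mathcal H$, i.e. the largest size of a finite set $S\subseteq\mathcal X$ such that every function $S\to\mathcal Y$ is the restriction of some $h\in\mathcal H$. Let $\epsilon,\delta\in(0,1)$, and let $\mathcal X=\hat{\mathcal X}\sqcup\tilde{\mathcal X}$ be a partition with $\lambda:=\mathcal D(\tilde{\mathcal X})>0$. Suppose that Exact returns $\hat\lambda=\mathcal D(\hat{\mathcal X})=1-\lambda$ and $\hat\ell_i=\sum_{x\in\hat{\mathcal X}}\mathcal D(x)\,L(h_i(x),f(x))$ for $i\in[k]$, and that successive calls of Gen return independent samples $x_1,x_2,\dots$ from the distribution $\tilde{\mathcal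 D}$ on $\tilde{\mathcal X}$ given by $\tilde{\mathcal D}(x)=\mathcal D(x)/\lambda$. **Algorithm (with constant $c>0$).** Put $\epsilon'=\epsilon/\lambda$, $n_0=\frac{c}{\epsilon'^2}\ln\frac1\delta$, $n_{\max}=\frac{c}{\epsilon'^2}\bigl(VC(\mathcal H)+\ln\frac1\delta\bigr)$, $R=\lceil\log_2(n_{\max}/n_0)\rceil$ (so $R\ge1$), $N_0=\lceil n_0\rceil$ and $N_{\max}=\lceil n_{\max}\rceil$. Choose $\delta_1,\dots,\delta_k>0$ with $\sum_{i=1}^k 2\delta_i=\delta/R$; they may be random, as long as they are independent of the samples $(x_j)_j$. Start with $N=N_0$ and repeat for at most $R$ rounds: for each $i$ let $z^{(i)}_j=L(h_i(x_j),f(x_j))$ for $j\le N$, let $$V_i=\frac1{N(N-1)}\sum_{1\le j_1<j_2\le N}\bigl(z^{(i)}_{j_1}-z^{(i)}_{j_2}\bigr)^2\quad(V_i=0\text{ if }N=1),\qquad \epsilon_i=\sqrt{\frac{2V_i\ln(2/\delta_i)}{N}}+\frac{7\ln(2/\delta_i)}{3N};$$ if $\max_i\epsilon_i\le\epsilon'$,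 leave the loop, and otherwise replace $N$ by $\min(2N,N_{\max})$. With the final value of $N$ put $\tilde\ell_i=\frac1N\sum_{j=1}^N L(h_i(x_j),f(x_j))$ and return $\ell_i=\hat\ell_i+\lambda\tilde\ell_i$ for $i\in[k]$. **Theorem.** There is an absolute constant $c_0>0$ such that for every $c\ge c_0$ and all data as above, the estimates returned by the algorithm satisfy $$\Pr\bigl[\forall i\in[k],\ |\mathcal R(h_i)-\ell_i|<\epsilon\bigr]\ge 1-\delta .$$ -/

import Mathlib

open MeasureTheory ProbabilityTheory

noncomputable section

namespace Saphyra

/-- The 0-1 loss. -/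
def loss {Y : Type*} (y' y : Y) : ℝ := by
  classical exact if y' = y then 0 else 1

/-- The probability, under the discrete distribution `D`, of a set `S` of samples. -/
def mass {X : Type*} (D : PMF X) (S : Set X) : ℝ := ∑' x : S, (D x).toReal

/-- The part of the expected risk of the hypothesis `g` that is contributed by the subspace `S`. -/
def riskOn {X Y : Type*} (D : PMF X) (f : X → Y) (S : Set X) (g : X → Y) : ℝ :=
  ∑' x : S, (D x).toReal * loss (g x) (f x)

/-- The expected risk of the hypothesis `g`. -/
def risk {X Y : Type*} (D : PMF X) (f g : X → Y) : ℝ :=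
  ∑' x : X, (D x).toReal * loss (g x) (f x)

/-- The renormalized distribution on the approximate subspace, i.e. the complement of the exact
subspace `Xhat`, as a probability mass function on the whole sample space. -/
def approxProb {X : Type*} (D : PMF X) (Xhat : Set X) (x : X) : ℝ := by
  classical exact if x ∈ Xhat then 0 else (D x).toReal / mass D Xhatᶜ

/-- The class `H` realizes every labelling of the finite set `S`. -/
def Shatters {X Y : Type*} (H : Set (X → Y)) (S : Finset X) : Prop :=
  ∀ g : S → Y, ∃ h ∈ H, ∀ x : S, h x = g x

/-- The VC-dimension: the largest size of a shattered set (for a nonempty finite class `H` with a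
two-element label space the set of sizes is nonempty and bounded). -/
def vcDim {X Y : Type*} (H : Set (X → Y)) : ℕ :=
  sSup {w : ℕ | ∃ S : Finset X, S.card = w ∧ Shatters H S}

/-- The sample variance of `z 0, …, z (N - 1)`. -/
def sampleVar (N : ℕ) (z : ℕ → ℝ) : ℝ :=
  1 / ((N : ℝ) * ((N : ℝ) - 1)) *
    ∑ j ∈ Finset.range N, ∑ i ∈ Finset.range j, (z i - z j) ^ 2

/-- The empirical mean of `z 0, …, z (N - 1)`. -/
def sampleMean (N : ℕ) (z : ℕ → ℝ) : ℝ := 1 / (N : ℝ) * ∑ j ∈ Finset.range N, z j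

/-- The empirical Bernstein error `ε(N, δ₀, v)` for `N` samples with sample variance `v`. -/
def bernsteinError (N : ℕ) (δ₀ v : ℝ) : ℝ :=
  √(1 / (N : ℝ) * (2 * v * Real.log (2 / δ₀))) + 7 * Real.log (2 / δ₀) / (3 * (N : ℝ))

/-- The initial number of samples, before rounding. -/
def initSize (c ε' δ : ℝ) : ℝ := c / ε' ^ 2 * Real.log (1 / δ)

/-- The maximum number of samples, before rounding. -/
def maxSize (c ε' δ : ℝ) (d : ℕ) : ℝ := c / ε' ^ 2 * ((d : ℝ) + Real.log (1 / δ))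

/-- The number of rounds `⌈log₂ (N_max / N₀)⌉`. -/
def rounds (c ε' δ : ℝ) (d : ℕ) : ℕ :=
  ⌈Real.logb 2 (maxSize c ε' δ d / initSize c ε' δ)⌉₊

/-- The adaptive doubling loop: `loop halt Nmax r N` is the final number of samples when `r` rounds
remain and the current number is `N`; `halt N` is the stopping criterion on the first `N`
samples. -/
def loop (halt : ℕ → Prop) (Nmax : ℕ) : ℕ → ℕ → ℕ
  | 0, N => N
  | r + 1, N => by
      classical exact if halt N then N else loop halt Nmax r (min (2 * N) Nmax)

/-- The number of samples with which the algorithm stops. Here `lam` is the weight of the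
approximate subspace, `dl i` the error probability allocated to the `i`-th hypothesis, and `x` the
sequence of samples, of which the algorithm looks at the first `N` when its current number of
samples is `N`. -/
def finalSize {X Y : Type*} {k : ℕ} (c ε δ lam : ℝ) (f : X → Y) (h : Fin k → X → Y)
    (dl : Fin k → ℝ) (x : ℕ → X) : ℕ :=
  let ε' := ε / lam
  let d := vcDim (Set.range h)
  loop
    (fun N => ∀ i, bernsteinError N (dl i) (sampleVar N fun j => loss (h i (x j)) (f (x j))) ≤ ε')
    ⌈maxSize c ε' δ d⌉₊ (rounds c ε' δ d) ⌈initSize c ε' δ⌉₊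

/-- The estimates returned by the algorithm, where `(lamHat, ellHat)` is the output of the
procedure for the exact subspace: `ℓ i = ellHat i + (1 - lamHat) * ℓ̃ i`. -/
def estimate {X Y : Type*} {k : ℕ} (c ε δ : ℝ) (f : X → Y) (h : Fin k → X → Y)
    (lamHat : ℝ) (ellHat : Fin k → ℝ) (dl : Fin k → ℝ) (x : ℕ → X) (i : Fin k) : ℝ :=
  let lam := 1 - lamHat
  ellHat i + lam *
    sampleMean (finalSize c ε δ lam f h dl x) fun j => loss (h i (x j)) (f (x j))

end Saphyra

end

namespace Saphyra

/-! The risk is the exact part plus λ times the error probability p_i of `h i` under the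
renormalized law μ, so an error of at least ε in the estimate is a deviation of at least ε' = ε/λ
between p_i and the empirical frequency. The stopping size depends on the data, but it lies on the
deterministic grid min(2^s N₀, Nmax), s ≤ R. Failures at s < R and at s = R are treated differently,
and each kind gets probability δ/2.

For s < R the stopping rule holds, so a bad estimate deviates by more than its empirical Bernstein
error. By `devRate_le_kl`, the rate (p-q)²/(2(q(1-q)+|p-q|)), which contains the empirical variance
q(1-q), is below the relative entropy. Chernoff's bound therefore makes exp(-N·rate) a p-value up to
a factor 2, and the Bernstein inequality forces it below half the level. A level that is independent
of the samples may be random: condition on it and integrate. Summing over hypotheses and rounds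
costs R·δ/(2R).

For s = R the sample has size Nmax and the stopping rule gives nothing, so a uniform bound without a
logarithmic factor is needed. A ghost sample and random swaps reduce it to random signs on N pairs.
Chaining over nets at scales 16⁻ˡ then gives N ε'² of order d + ln(1/δ). The size of the nets is
controlled by a packing bound: logarithmically many random positions already distinguish the members
of a separated family, and Sauer-Shelah counts their traces. -/

/-! ### Packing bounds for families of bounded VC-dimension -/

open Finset in
/-- The VC-dimension of a family of sets does not grow under preimages. -/
theorem vcDim_image_preimage_le {α β : Type*} [Fintype α] [DecidableEq α] [DecidableEq β]
    (𝒜 : Finset (Finset β)) (y : α → β) :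
    (𝒜.image fun A => univ.filter fun a => y a ∈ A).vcDim ≤ 𝒜.vcDim := by
  refine Finset.sup_le fun s hs => ?_
  rw [mem_shatterer] at hs
  have hsh : ∀ t ⊆ s, ∃ A ∈ 𝒜, ∀ a ∈ s, y a ∈ A ↔ a ∈ t := by
    intro t ht
    obtain ⟨u, hu, hut⟩ := hs ht
    obtain ⟨A, hA, rfl⟩ := mem_image.1 hu
    refine ⟨A, hA, fun a ha => ?_⟩
    rw [← hut]
    simp [ha]
  -- The singleton {a} is a trace, and the set producing it would contain y b = y a.
  have hinj : Set.InjOn y s := by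
    intro a ha b hb hab
    obtain ⟨A, -, hA⟩ := hsh {a} (by simpa using ha)
    have h1 := hA a ha
    have h2 := hA b hb
    rw [hab] at h1
    have h3 : b ∈ ({a} : Finset α) := (h2.symm.trans h1).2 (by simp)
    exact (mem_singleton.1 h3).symm
  rw [← card_image_of_injOn hinj]
  refine Shatters.card_le_vcDim fun t ht => ?_
  obtain ⟨A, hA, hAt⟩ := hsh (s.filter fun a => y a ∈ t) (filter_subset _ _)
  refine ⟨A, hA, ?_⟩
  ext b
  simp only [mem_inter, mem_image]
  constructor
  · rintro ⟨⟨a, ha, rfl⟩, hb⟩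
    exact (mem_filter.1 ((hAt a ha).1 hb)).2
  · intro hb
    obtain ⟨a, ha, rfl⟩ := mem_image.1 (ht hb)
    exact ⟨⟨a, ha, rfl⟩, (hAt a ha).2 (mem_filter.2 ⟨ha, hb⟩)⟩

/-- A partial sum of binomial coefficients is bounded by `u⁻ᵈ (1 + u)ᵐ`. -/
theorem sum_choose_le (m d : ℕ) {u : ℝ} (hu : 0 < u) (hu1 : u ≤ 1) :
    (∑ i ∈ Finset.Iic d, (m.choose i : ℝ)) ≤ (1 / u) ^ d * (1 + u) ^ m := by
  have h1 : (1 + u) ^ m = ∑ i ∈ Finset.range (m + 1), u ^ i * (m.choose i : ℝ) := by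
    rw [add_comm, add_pow]; simp
  have h2 : ∑ i ∈ Finset.Iic d, u ^ i * (m.choose i : ℝ) ≤ (1 + u) ^ m := by
    rw [h1]
    rw [← Finset.sum_filter_add_sum_filter_not (Finset.Iic d) (fun i => i < m + 1)]
    have : ∑ i ∈ (Finset.Iic d).filter (fun i => ¬ i < m + 1), u ^ i * (m.choose i : ℝ) = 0 := by
      refine Finset.sum_eq_zero fun i hi => ?_
      have : m < i := by simp at hi; omega
      simp [Nat.choose_eq_zero_of_lt this]
    rw [this, add_zero]
    refine Finset.sum_le_sum_of_subset_of_nonneg ?_ fun i _ _ => by positivity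
    intro i hi
    simp at hi ⊢
    omega
  calc (∑ i ∈ Finset.Iic d, (m.choose i : ℝ))
      ≤ ∑ i ∈ Finset.Iic d, (1 / u) ^ d * (u ^ i * (m.choose i : ℝ)) := by
        refine Finset.sum_le_sum fun i hi => ?_
        have hid : i ≤ d := Finset.mem_Iic.1 hi
        rw [← mul_assoc]
        refine le_mul_of_one_le_left (by positivity) ?_
        obtain ⟨e, rfl⟩ := Nat.exists_eq_add_of_le hid
        rw [pow_add, mul_right_comm, ← mul_pow, one_div_mul_cancel hu.ne', one_pow, one_mul]
        exact one_le_pow₀ (by rw [le_div_iff₀ hu]; linarith)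
    _ = (1 / u) ^ d * ∑ i ∈ Finset.Iic d, u ^ i * (m.choose i : ℝ) := by rw [Finset.mul_sum]
    _ ≤ _ := by gcongr

/-- A consequence of the Sauer-Shelah lemma. -/
theorem card_le_of_vcDim_le {α : Type*} [Fintype α] [DecidableEq α] (𝒜 : Finset (Finset α))
    {d : ℕ} (hd : 𝒜.vcDim ≤ d) {u : ℝ} (hu : 0 < u) (hu1 : u ≤ 1) :
    (𝒜.card : ℝ) ≤ (1 / u) ^ d * Real.exp (u * Fintype.card α) := by
  have h1 : 𝒜.card ≤ ∑ i ∈ Finset.Iic d, (Fintype.card α).choose i :=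
    (𝒜.card_le_card_shatterer.trans Finset.card_shatterer_le_sum_vcDim).trans
      (Finset.sum_le_sum_of_subset (Finset.Iic_subset_Iic.2 hd))
  have h2 : (𝒜.card : ℝ) ≤ ∑ i ∈ Finset.Iic d, ((Fintype.card α).choose i : ℝ) := by
    exact_mod_cast h1
  refine h2.trans ((sum_choose_le _ d hu hu1).trans ?_)
  rw [mul_comm u, Real.exp_nat_mul]
  gcongr
  rw [add_comm]
  exact Real.add_one_le_exp u

open Finset in
/-- If pairwise differences are large, some `m` positions distinguish all sets of a family. -/
theorem exists_positions_injOn {J : Type*} [Fintype J] [DecidableEq J] (𝒬 : Finset (Finset J))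
    {θ : ℝ} (hsep : ∀ A ∈ 𝒬, ∀ B ∈ 𝒬, A ≠ B → θ * Fintype.card J ≤ #(symmDiff A B))
    (hJ : 0 < Fintype.card J) {m : ℕ}
    (hm : (#𝒬 : ℝ) ^ 2 * Real.exp (-(θ * m)) ≤ 1) (hne : 𝒬.Nonempty) :
    ∃ y : Fin m → J, Set.InjOn (fun A => univ.filter fun a => y a ∈ A) (𝒬 : Set (Finset J)) := by
  by_contra hcon
  push Not at hcon
  set n := Fintype.card J with hn
  have hn0 : (0 : ℝ) < n := by exact_mod_cast hJ
  -- Counting form of the probabilistic method: a bad tuple of positions avoids A ∆ B for some pair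
  -- A ≠ B, and each pair accounts for at most a fraction (1-θ)^m ≤ e^(-θm) of all tuples.
  have hcover : (univ : Finset (Fin m → J)) ⊆
      𝒬.offDiag.biUnion fun p => Fintype.piFinset fun _ => (symmDiff p.1 p.2)ᶜ := by
    intro y _
    have := hcon y
    simp only [Set.InjOn, not_forall] at this
    obtain ⟨A, hA, B, hB, hAB, hne⟩ := this
    refine mem_biUnion.2 ⟨(A, B), mem_offDiag.2 ⟨hA, hB, hne⟩, ?_⟩
    rw [Fintype.mem_piFinset]
    intro a
    have := Finset.ext_iff.1 hAB a
    simp only [mem_filter, mem_univ, true_and] at this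
    simp only [mem_compl, mem_symmDiff]
    tauto
  have hcard : (n : ℝ) ^ m ≤ (#𝒬.offDiag : ℝ) * (n ^ m * Real.exp (-(θ * m))) := by
    have h1 : n ^ m ≤ ∑ p ∈ 𝒬.offDiag, #(Fintype.piFinset fun _ : Fin m => (symmDiff p.1 p.2)ᶜ) := by
      have := (card_le_card hcover).trans card_biUnion_le
      simpa [hn] using this
    have h2 : (n : ℝ) ^ m ≤
        ∑ p ∈ 𝒬.offDiag, (#(Fintype.piFinset fun _ : Fin m => (symmDiff p.1 p.2)ᶜ) : ℝ) := by
      exact_mod_cast h1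
    refine h2.trans ?_
    rw [← nsmul_eq_mul]
    refine sum_le_card_nsmul _ _ _ fun p hp => ?_
    rw [mem_offDiag] at hp
    have hs := hsep _ hp.1 _ hp.2.1 hp.2.2
    rw [Fintype.card_piFinset]
    simp only [prod_const, card_univ, Fintype.card_fin, Nat.cast_pow]
    rw [show -(θ * m) = m * (-θ) by ring, Real.exp_nat_mul, ← mul_pow]
    gcongr
    rw [card_compl, Nat.cast_sub (card_le_univ _)]
    have := Real.add_one_le_exp (-θ)
    nlinarith
  -- Dropping the diagonal supplies the strictness that contradicts `hm`.
  have hoff : (#𝒬.offDiag : ℝ) < (#𝒬 : ℝ) ^ 2 := by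
    have h0 : 0 < #𝒬 := hne.card_pos
    have : #𝒬.offDiag < #𝒬 ^ 2 := by
      rw [offDiag_card, sq]
      exact Nat.sub_lt (by positivity) h0
    exact_mod_cast this
  have hpos : (0 : ℝ) < n ^ m := by positivity
  have he := Real.exp_pos (-(θ * m))
  have : (#𝒬.offDiag : ℝ) * Real.exp (-(θ * m)) < 1 :=
    (mul_lt_mul_of_pos_right hoff he).trans_le hm
  nlinarith

open Finset in
/-- A bound for the size of a separated subfamily of a family of bounded VC-dimension. -/
theorem card_le_of_separated {J : Type*} [Fintype J] [DecidableEq J] (𝒬 : Finset (Finset J))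
    {d : ℕ} (hd : 𝒬.vcDim ≤ d) (hd1 : 1 ≤ d) (hJ : 0 < Fintype.card J)
    {θ : ℝ} (hθ : 0 < θ) (hθ1 : θ ≤ 1)
    (hsep : ∀ A ∈ 𝒬, ∀ B ∈ 𝒬, A ≠ B → θ * Fintype.card J ≤ #(symmDiff A B)) :
    (#𝒬 : ℝ) ≤ (8 / θ) ^ (2 * d) := by
  rcases 𝒬.eq_empty_or_nonempty with rfl | hne
  · simp; positivity
  have hM1 : (1 : ℝ) ≤ #𝒬 := by exact_mod_cast hne.card_pos
  have hM0 : (0 : ℝ) < #𝒬 := by linarith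
  set M : ℝ := (#𝒬 : ℝ) with hM
  have hlog : 0 ≤ Real.log M := Real.log_nonneg hM1
  set m := ⌈2 * Real.log M / θ⌉₊ with hm
  have hm1 : 2 * Real.log M ≤ θ * m := by
    have := Nat.le_ceil (2 * Real.log M / θ)
    rw [div_le_iff₀ hθ] at this
    linarith
  have hm2 : θ * m ≤ 2 * Real.log M + θ := by
    have := (Nat.ceil_lt_add_one (a := 2 * Real.log M / θ) (by positivity)).le
    have h3 := mul_le_mul_of_nonneg_left this hθ.le
    rw [mul_add, mul_div_cancel₀ _ hθ.ne'] at h3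
    linarith
  obtain ⟨y, hy⟩ := exists_positions_injOn 𝒬 hsep hJ (m := m) (by
    have : M ^ 2 = Real.exp (2 * Real.log M) := by
      rw [two_mul, Real.exp_add, Real.exp_log hM0, sq]
    rw [this, ← Real.exp_add]
    exact Real.exp_le_one_iff.2 (by linarith)) hne
  -- Since θm is about 2 log M, the choice u = θ/4 makes the exponential term about (log M)/2, which
  -- the left side absorbs.
  have hc := card_le_of_vcDim_le _ ((vcDim_image_preimage_le 𝒬 y).trans hd)
    (u := θ / 4) (by positivity) (by linarith)
  rw [card_image_of_injOn hy, Fintype.card_fin] at hc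
  have h4 : 0 < 1 / (θ / 4) := by positivity
  have hl := Real.log_le_log hM0 hc
  rw [Real.log_mul (by positivity) (by positivity), Real.log_exp, Real.log_pow] at hl
  have hl2 : Real.log M ≤ 2 * d * Real.log (1 / (θ / 4)) + 1 := by nlinarith
  have h8 : Real.log (8 / θ) = Real.log (1 / (θ / 4)) + Real.log 2 := by
    rw [← Real.log_mul (by positivity) (by norm_num)]
    congr 1; field_simp; norm_num
  have hd1' : (1 : ℝ) ≤ d := by exact_mod_cast hd1
  -- The passage from 4/θ to 8/θ pays for the additive 1, because 2d log 2 ≥ 1 when d ≥ 1.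
  rw [← Real.log_le_log_iff hM0 (by positivity), Real.log_pow, h8]
  push_cast
  nlinarith [Real.log_two_gt_d9]

open Finset in
/-- A family of sets contains a maximal separated subfamily. -/
theorem exists_separated_net {J : Type*} [Fintype J] [DecidableEq J] (𝒜 : Finset (Finset J))
    {r : ℝ} (hr : 0 < r) :
    ∃ 𝒩 ⊆ 𝒜, (∀ A ∈ 𝒩, ∀ B ∈ 𝒩, A ≠ B → r ≤ #(symmDiff A B)) ∧
      ∀ A ∈ 𝒜, ∃ B ∈ 𝒩, (#(symmDiff A B) : ℝ) < r := by
  classical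
  let S := 𝒜.powerset.filter fun 𝒩 => ∀ A ∈ 𝒩, ∀ B ∈ 𝒩, A ≠ B → r ≤ #(symmDiff A B)
  obtain ⟨𝒩, h𝒩, hmax⟩ := S.exists_max_image card ⟨∅, by simp [S]⟩
  simp only [S, mem_filter, mem_powerset] at h𝒩 hmax
  refine ⟨𝒩, h𝒩.1, h𝒩.2, fun A hA => ?_⟩
  by_contra! hcon
  have hAn : A ∉ 𝒩 := fun h => by
    have := hcon A h
    simp at this
    linarith
  have := hmax (insert A 𝒩) ⟨insert_subset hA h𝒩.1, ?_⟩
  · rw [card_insert_of_notMem hAn] at this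
    omega
  · intro B hB C hC hBC
    rcases mem_insert.1 hB with rfl | hB' <;> rcases mem_insert.1 hC with rfl | hC'
    · exact absurd rfl hBC
    · exact hcon _ hC'
    · rw [symmDiff_comm]; exact hcon _ hB'
    · exact h𝒩.2 _ hB' _ hC' hBC

/-! ### Concentration of random signs -/

/-- The sign attached to a Boolean. -/
def boolSign (b : Bool) : ℝ := if b then 1 else -1

/-- The sum factors over the coordinates, and each factor is 2 cosh a ≤ 2 exp(a²/2). -/
theorem sum_exp_signs {N : ℕ} (a : Fin N → ℝ) :
    ∑ σ : Fin N → Bool, Real.exp (∑ j, boolSign (σ j) * a j) ≤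
      2 ^ N * Real.exp ((∑ j, a j ^ 2) / 2) := by
  have h1 : ∑ σ : Fin N → Bool, Real.exp (∑ j, boolSign (σ j) * a j) =
      ∏ j, ∑ b : Bool, Real.exp (boolSign b * a j) := by
    rw [Finset.prod_univ_sum, Fintype.piFinset_univ]
    simp_rw [Real.exp_sum]
  rw [h1]
  calc ∏ j, ∑ b : Bool, Real.exp (boolSign b * a j)
      ≤ ∏ j, 2 * Real.exp (a j ^ 2 / 2) := by
        refine Finset.prod_le_prod (fun j _ => by positivity) fun j _ => ?_
        have := Real.cosh_le_exp_half_sq (a j)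
        rw [Real.cosh_eq] at this
        simp only [Fintype.univ_bool, boolSign, Finset.mem_singleton, Bool.true_eq_false,
          not_false_eq_true, Finset.sum_insert, if_true, one_mul, Finset.sum_singleton,
          Bool.false_eq_true, if_false, neg_mul]
        linarith
    _ = _ := by
        rw [Finset.prod_mul_distrib, ← Real.exp_sum, Finset.sum_div]
        simp

-- Markov's inequality for the exponential moment with tilt t/q, which minimizes s²q/2 - st over s.
open Finset in
theorem card_signs_ge_le {N : ℕ} (a : Fin N → ℝ) {t q : ℝ} (ht : 0 ≤ t) (hq : 0 < q)
    (haq : ∑ j, a j ^ 2 ≤ q) :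
    (#{σ : Fin N → Bool | t ≤ ∑ j, boolSign (σ j) * a j} : ℝ) ≤
      2 ^ N * Real.exp (-(t ^ 2 / (2 * q))) := by
  have h1 := sum_exp_signs fun j => t / q * a j
  have h2 : (#{σ : Fin N → Bool | t ≤ ∑ j, boolSign (σ j) * a j} : ℝ) * Real.exp (t / q * t) ≤
      ∑ σ : Fin N → Bool, Real.exp (∑ j, boolSign (σ j) * (t / q * a j)) := by
    rw [← nsmul_eq_mul]
    refine (card_nsmul_le_sum _ _ _ fun σ hσ => ?_).trans
      (sum_le_sum_of_subset_of_nonneg (subset_univ _) fun _ _ _ => (Real.exp_pos _).le)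
    refine Real.exp_le_exp.2 ?_
    have : ∑ j, boolSign (σ j) * (t / q * a j) = t / q * ∑ j, boolSign (σ j) * a j := by
      rw [mul_sum]; exact sum_congr rfl fun _ _ => by ring
    rw [this]
    exact mul_le_mul_of_nonneg_left (mem_filter.1 hσ).2 (by positivity)
  have h3 : (∑ j, (t / q * a j) ^ 2) / 2 ≤ t ^ 2 / (2 * q) := by
    simp_rw [mul_pow]
    rw [← mul_sum]
    calc (t / q) ^ 2 * (∑ j, a j ^ 2) / 2 ≤ (t / q) ^ 2 * q / 2 := by gcongr
      _ = _ := by field_simp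
  have h4 := (h2.trans h1).trans
    (mul_le_mul_of_nonneg_left (Real.exp_le_exp.2 h3) (by positivity))
  have h5 : Real.exp (-(t ^ 2 / (2 * q))) = Real.exp (t ^ 2 / (2 * q)) / Real.exp (t / q * t) := by
    rw [← Real.exp_sub]; congr 1; field_simp; ring
  rw [h5, ← mul_div_assoc, le_div_iff₀ (Real.exp_pos _)]
  exact h4

open Finset in
/-- Hoeffding's inequality for uniformly distributed signs. -/
theorem card_signs_abs_ge_le {N : ℕ} (a : Fin N → ℝ) {t q : ℝ} (ht : 0 ≤ t) (hq : 0 < q)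
    (haq : ∑ j, a j ^ 2 ≤ q) :
    (#{σ : Fin N → Bool | t ≤ |∑ j, boolSign (σ j) * a j|} : ℝ) ≤
      2 ^ N * (2 * Real.exp (-(t ^ 2 / (2 * q)))) := by
  have h1 := card_signs_ge_le a ht hq haq
  have h2 := card_signs_ge_le (fun j => -a j) ht hq (by simpa using haq)
  have h3 : (univ.filter fun σ : Fin N → Bool => t ≤ |∑ j, boolSign (σ j) * a j|) ⊆
      (univ.filter fun σ : Fin N → Bool => t ≤ ∑ j, boolSign (σ j) * a j) ∪
      (univ.filter fun σ : Fin N → Bool => t ≤ ∑ j, boolSign (σ j) * -a j) := by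
    intro σ hσ
    simp only [mem_filter, mem_univ, true_and, mem_union, mul_neg, sum_neg_distrib] at hσ ⊢
    exact le_abs.1 hσ
  have h4 : (#{σ : Fin N → Bool | t ≤ |∑ j, boolSign (σ j) * a j|} : ℝ) ≤
      #{σ : Fin N → Bool | t ≤ ∑ j, boolSign (σ j) * a j} +
      #{σ : Fin N → Bool | t ≤ ∑ j, boolSign (σ j) * -a j} := by
    exact_mod_cast (card_le_card h3).trans (card_union_le _ _)
  linarith

/-! ### Chaining over nets on pairs of positions -/

/-- The difference of the indicators of `A` at the two members of the `j`-th pair. -/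
def pairDiff {N : ℕ} (A : Finset (Fin N × Bool)) (j : Fin N) : ℝ :=
  (if (j, true) ∈ A then 1 else 0) - (if (j, false) ∈ A then 1 else 0)

/-- The signed sum of the differences of the indicators of `A` over all pairs. -/
def signedDiff {N : ℕ} (σ : Fin N → Bool) (A : Finset (Fin N × Bool)) : ℝ :=
  ∑ j, boolSign (σ j) * pairDiff A j

/-- If A and B disagree at n ≤ 2 members of a pair, that pair contributes at most n² ≤ 2n. -/
theorem sum_pairDiff_sub_sq_le {N : ℕ} (A B : Finset (Fin N × Bool)) :
    ∑ j, (pairDiff A j - pairDiff B j) ^ 2 ≤ 2 * ((symmDiff A B).card : ℝ) := by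
  have h1 : ((symmDiff A B).card : ℝ) =
      ∑ j : Fin N, ∑ b : Bool, if (j, b) ∈ symmDiff A B then (1 : ℝ) else 0 := by
    rw [← Fintype.sum_prod_type']
    simp
  rw [h1, Finset.mul_sum]
  refine Finset.sum_le_sum fun j _ => ?_
  simp only [Fintype.univ_bool, Finset.mem_singleton, Bool.true_eq_false,
    not_false_eq_true, Finset.sum_insert, Finset.sum_singleton, Finset.mem_symmDiff, pairDiff]
  by_cases h1 : (j, true) ∈ A <;> by_cases h2 : (j, false) ∈ A <;>
    by_cases h3 : (j, true) ∈ B <;> by_cases h4 : (j, false) ∈ B <;> simp [h1, h2, h3, h4] <;>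
    norm_num

theorem signedDiff_sub {N : ℕ} (σ : Fin N → Bool) (A B : Finset (Fin N × Bool)) :
    signedDiff σ A - signedDiff σ B =
      ∑ j, boolSign (σ j) * (pairDiff A j - pairDiff B j) := by
  simp only [signedDiff, ← Finset.sum_sub_distrib, mul_sub]

theorem signedDiff_empty {N : ℕ} (σ : Fin N → Bool) : signedDiff σ ∅ = 0 := by
  simp [signedDiff, pairDiff]

/-- If every link of the chains through the nets has a small increment, so has every set. -/
theorem abs_lt_of_chain {β : Type*} (g : β → ℝ) (𝒩 : ℕ → Finset β) (π : ℕ → β → β) (o : β)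
    (ho : g o = 0) (hπ0 : ∀ A, π 0 A = o) (hπ : ∀ l, ∀ A ∈ 𝒩 (l + 1), π (l + 1) A ∈ 𝒩 l)
    {τ : ℝ} {T : ℕ} (hlink : ∀ l ≤ T, ∀ A ∈ 𝒩 l, |g A - g (π l A)| < τ * (1 / 2) ^ (l + 1))
    (l : ℕ) (hl : l ≤ T) : ∀ A ∈ 𝒩 l, |g A| < τ * (1 - (1 / 2) ^ (l + 1)) := by
  induction l with
  | zero =>
    intro A hA
    have := hlink 0 hl A hA
    rw [hπ0, ho, sub_zero] at this
    norm_num at this ⊢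
    exact this
  | succ l ih =>
    intro A hA
    have h1 := hlink (l + 1) hl A hA
    have h2 := ih (by omega) _ (hπ l A hA)
    have h3 := abs_sub_abs_le_abs_sub (g A) (g (π (l + 1) A))
    rw [pow_succ] at h1 ⊢
    linarith

open Finset in
/-- Nets at the scales `16⁻ˡ` of a family of sets on `N` pairs of positions, with maps to the
previous net. -/
theorem exists_nets {N : ℕ} (hN : 0 < N) (𝒜 : Finset (Finset (Fin N × Bool)))
    {d : ℕ} (hd : 𝒜.vcDim ≤ d) (hd1 : 1 ≤ d) :
    ∃ (𝒩 : ℕ → Finset (Finset (Fin N × Bool)))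
      (π : ℕ → Finset (Fin N × Bool) → Finset (Fin N × Bool)) (T : ℕ),
      (∀ l, (#(𝒩 l) : ℝ) ≤ Real.exp (6 * d * (l + 1))) ∧ (∀ A, π 0 A = ∅) ∧
      (∀ l, ∀ A ∈ 𝒩 (l + 1), π (l + 1) A ∈ 𝒩 l) ∧
      (∀ l, ∀ A ∈ 𝒩 l, (#(symmDiff A (π l A)) : ℝ) ≤ 32 * N / 16 ^ l) ∧ 𝒜 ⊆ 𝒩 T := by
  have hN0 : (0 : ℝ) < N := by exact_mod_cast hN
  have hcardJ : (Fintype.card (Fin N × Bool) : ℝ) = 2 * N := by simp; ring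
  choose 𝒩 hsub hsep hnet using fun l : ℕ =>
    exists_separated_net 𝒜 (r := (1 / 16 ^ l) * (2 * N)) (by positivity)
  choose! ρ hρ using hnet
  -- Every chain starts at ∅, and A at level l+1 maps to a near point at level l. Level 2N is fine
  -- enough for its net to contain all of 𝒜.
  refine ⟨𝒩, fun l A => Nat.casesOn l ∅ fun l => ρ l A, 2 * N, ?_, fun A => rfl, ?_, ?_, ?_⟩
  · intro l
    have h1 := card_le_of_separated (𝒩 l) ((vcDim_mono (hsub l)).trans hd) hd1
      (by simp; omega) (θ := 1 / 16 ^ l) (by positivity)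
      (by rw [div_le_one (by positivity)]; exact one_le_pow₀ (by norm_num))
      (by rw [hcardJ]; exact hsep l)
    refine h1.trans ?_
    have he : (20 : ℝ) ≤ Real.exp 3 := by
      have h := Real.exp_one_gt_d9
      have : Real.exp 3 = Real.exp 1 ^ 3 := by rw [← Real.exp_nat_mul]; norm_num
      rw [this]
      calc (20 : ℝ) ≤ 2.718 ^ 3 := by norm_num
        _ ≤ _ := by gcongr; linarith
    have h2 : 8 / (1 / (16 : ℝ) ^ l) ≤ Real.exp 3 ^ (l + 1) := by
      rw [pow_succ, div_div_eq_mul_div, div_one, mul_comm]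
      gcongr <;> linarith
    calc (8 / (1 / (16 : ℝ) ^ l)) ^ (2 * d) ≤ (Real.exp 3 ^ (l + 1)) ^ (2 * d) := by gcongr
      _ = _ := by
        rw [← pow_mul, ← Real.exp_nat_mul]; congr 1; push_cast; ring
  · intro l A hA
    exact (hρ l A (hsub _ hA)).1
  · intro l A hA
    rcases l with _ | l
    · have h1 : #(symmDiff A ∅) ≤ Fintype.card (Fin N × Bool) := card_le_univ _
      have h2 : (#(symmDiff A ∅) : ℝ) ≤ 2 * N := by rw [← hcardJ]; exact_mod_cast h1
      refine h2.trans ?_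
      rw [pow_zero, div_one]
      linarith
    · have := (hρ l A (hsub _ hA)).2.le
      refine this.trans (le_of_eq ?_)
      rw [pow_succ]; field_simp; norm_num
  · intro A hA
    obtain ⟨h1, h2⟩ := hρ (2 * N) A hA
    -- Below radius 1 a symmetric difference is empty, so the nearest net point is A itself.
    have h3 : (1 / 16 ^ (2 * N)) * (2 * N) ≤ (1 : ℝ) := by
      rw [one_div_mul_eq_div, div_le_one (by positivity)]
      have : 2 * N < 16 ^ (2 * N) := Nat.lt_pow_self (by norm_num)
      exact_mod_cast this.le
    have h4 : #(symmDiff A (ρ (2 * N) A)) = 0 := by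
      have := h2.trans_le h3
      have : #(symmDiff A (ρ (2 * N) A)) < 1 := by exact_mod_cast this
      omega
    rw [card_eq_zero, ← bot_eq_empty, symmDiff_eq_bot] at h4
    rwa [h4]

theorem sum_geometric_exp_le {Q : ℝ} (hQ : 1 ≤ Q) (T : ℕ) :
    ∑ l ∈ Finset.range (T + 1), 2 * Real.exp (-(Q * (l + 1))) ≤ 4 * Real.exp (-Q) := by
  have hQe : Real.exp (-Q) ≤ 1 / 2 := by
    have h1 := Real.add_one_le_exp Q
    rw [Real.exp_neg, ← one_div]
    exact one_div_le_one_div_of_le (by norm_num) (by linarith)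
  have h2 : ∀ l : ℕ, 2 * Real.exp (-(Q * (l + 1))) ≤ 2 * Real.exp (-Q) * (1 / 2) ^ l := by
    intro l
    have : Real.exp (-(Q * (l + 1))) = Real.exp (-Q) * Real.exp (-Q) ^ l := by
      rw [← Real.exp_nat_mul, ← Real.exp_add]; congr 1; ring
    rw [this, ← mul_assoc]
    gcongr
  refine (Finset.sum_le_sum fun l _ => h2 l).trans ?_
  rw [← Finset.mul_sum]
  have := (summable_geometric_two).sum_le_tsum (Finset.range (T + 1)) (fun _ _ => by positivity)
  rw [tsum_geometric_two] at this
  nlinarith [Real.exp_pos (-Q)]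

open Finset in
/-- Chaining: for most choices of the signs, all sets of a family of bounded VC-dimension have a
small signed difference. -/
theorem card_signs_exists_le {N : ℕ} (hN : 0 < N) (𝒜 : Finset (Finset (Fin N × Bool)))
    {d : ℕ} (hd : 𝒜.vcDim ≤ d) (hd1 : 1 ≤ d) {η Q : ℝ} (hη : 0 < η) (hQ : 1 ≤ Q)
    (hbig : 6 * d + Q ≤ N * η ^ 2 / 512) :
    (#{σ : Fin N → Bool | ∃ A ∈ 𝒜, N * η ≤ |signedDiff σ A|} : ℝ) ≤
      2 ^ N * (4 * Real.exp (-Q)) := by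
  have hN0 : (0 : ℝ) < N := by exact_mod_cast hN
  obtain ⟨𝒩, π, T, hcard, hπ0, hπ, hdist, hT⟩ := exists_nets hN 𝒜 hd hd1
  have hcover : (univ.filter fun σ : Fin N → Bool => ∃ A ∈ 𝒜, N * η ≤ |signedDiff σ A|) ⊆
      (range (T + 1)).biUnion fun l => (𝒩 l).biUnion fun A =>
        univ.filter fun σ : Fin N → Bool => N * η * (1 / 2) ^ (l + 1) ≤
          |∑ j, boolSign (σ j) * (pairDiff A j - pairDiff (π l A) j)| := by
    intro σ hσ
    obtain ⟨A, hA, hσA⟩ := (mem_filter.1 hσ).2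
    by_contra hcon
    simp only [mem_biUnion, mem_filter, mem_univ, true_and, not_exists, not_and, not_le,
      mem_range, Nat.lt_succ_iff] at hcon
    have := abs_lt_of_chain (signedDiff σ) 𝒩 π ∅ (signedDiff_empty σ) hπ0 hπ
      (τ := N * η) (T := T) (fun l hl B hB => by
        rw [signedDiff_sub]; exact hcon l (by omega) B hB) T le_rfl A (hT hA)
    have h2 : N * η * (1 - (1 / 2) ^ (T + 1)) ≤ N * η := by
      refine mul_le_of_le_one_right (by positivity) ?_
      have : (0 : ℝ) < (1 / 2) ^ (T + 1) := by positivity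
      linarith
    linarith
  have hlevel : ∀ l, ∀ A ∈ 𝒩 l, (#(univ.filter fun σ : Fin N → Bool =>
      N * η * (1 / 2) ^ (l + 1) ≤
        |∑ j, boolSign (σ j) * (pairDiff A j - pairDiff (π l A) j)|) : ℝ) ≤
      2 ^ N * (2 * Real.exp (-((6 * d + Q) * (l + 1)))) := by
    intro l A hA
    have h1 := card_signs_abs_ge_le (fun j => pairDiff A j - pairDiff (π l A) j)
      (t := N * η * (1 / 2) ^ (l + 1)) (q := 64 * N / 16 ^ l) (by positivity) (by positivity)
      ((sum_pairDiff_sub_sq_le _ _).trans (by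
        have := hdist l A hA
        calc 2 * (#(symmDiff A (π l A)) : ℝ) ≤ 2 * (32 * N / 16 ^ l) := by gcongr
          _ = _ := by ring))
    refine h1.trans ?_
    gcongr
    -- The squared threshold shrinks like 4⁻ˡ but the variance like 16⁻ˡ, so the exponent gains 4ˡ ≥
    -- l+1, enough to outweigh the growth of the nets.
    have h2 : (N * η * (1 / 2) ^ (l + 1)) ^ 2 / (2 * (64 * N / 16 ^ l)) =
        N * η ^ 2 / 512 * (4 : ℝ) ^ l := by
      have h16 : (16 : ℝ) ^ l = 4 ^ l * 4 ^ l := by rw [← mul_pow]; norm_num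
      have h4 : ((1 / 2 : ℝ) ^ (l + 1)) ^ 2 = 1 / (4 * 4 ^ l) := by
        rw [← pow_mul, mul_comm, pow_mul, ← pow_succ', one_div_pow]; norm_num
        rw [pow_succ, pow_succ, one_div_pow]; simp [mul_comm]
      rw [mul_pow, h4, h16]
      field_simp
      norm_num
    rw [h2]
    have h3 : (l + 1 : ℝ) ≤ 4 ^ l := by
      have : l < 4 ^ l := Nat.lt_pow_self (by norm_num)
      exact_mod_cast this
    gcongr
  have hsum : (#{σ : Fin N → Bool | ∃ A ∈ 𝒜, N * η ≤ |signedDiff σ A|} : ℝ) ≤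
      ∑ l ∈ range (T + 1), ∑ A ∈ 𝒩 l, (2 ^ N * (2 * Real.exp (-((6 * d + Q) * (l + 1)))) : ℝ) := by
    have h1 := (card_le_card hcover).trans card_biUnion_le
    refine (Nat.cast_le.2 h1).trans ?_
    push_cast
    refine sum_le_sum fun l _ => ?_
    refine (Nat.cast_le.2 card_biUnion_le).trans ?_
    push_cast
    exact sum_le_sum fun A hA => hlevel l A hA
  refine hsum.trans ?_
  refine le_trans ?_ (mul_le_mul_of_nonneg_left (sum_geometric_exp_le hQ T) (by positivity))
  rw [mul_sum]
  refine sum_le_sum fun l _ => ?_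
  rw [sum_const, nsmul_eq_mul]
  calc (#(𝒩 l) : ℝ) * (2 ^ N * (2 * Real.exp (-((6 * d + Q) * (l + 1)))))
      ≤ Real.exp (6 * d * (l + 1)) * (2 ^ N * (2 * Real.exp (-((6 * d + Q) * (l + 1))))) := by
        gcongr; exact hcard l
    _ = 2 ^ N * (2 * (Real.exp (6 * d * (l + 1)) * Real.exp (-((6 * d + Q) * (l + 1))))) := by
        ring
    _ = _ := by rw [← Real.exp_add]; congr 3; ring

/-! ### Chernoff bound with an empirical-variance rate -/

/-- The number of entries of `x` that lie in `C`. -/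
noncomputable def hitCount {X : Type*} {N : ℕ} (C : Set X) (x : Fin N → X) : ℕ := by
  classical exact (Finset.univ.filter fun j => x j ∈ C).card

theorem hitCount_le {X : Type*} {N : ℕ} (C : Set X) (x : Fin N → X) : hitCount C x ≤ N := by
  classical
  unfold hitCount
  exact (Finset.card_le_univ _).trans (by simp)

theorem hitCount_compl {X : Type*} {N : ℕ} (C : Set X) (x : Fin N → X) :
    (hitCount Cᶜ x : ℝ) = N - hitCount C x := by
  classical
  have h : hitCount C x + hitCount Cᶜ x = N := by
    unfold hitCount
    have := Finset.card_filter_add_card_filter_not (s := Finset.univ) (fun j => x j ∈ C)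
    simpa using this
  rw [eq_sub_iff_add_eq, add_comm]
  exact_mod_cast h

/-- An exponential rate for the deviation of an empirical frequency `q` from a probability `p`. -/
noncomputable def devRate (q p : ℝ) : ℝ := (p - q) ^ 2 / (2 * (q * (1 - q) + |p - q|))

theorem devRate_one_sub (q p : ℝ) : devRate (1 - q) (1 - p) = devRate q p := by
  unfold devRate
  rw [show (1 - p) - (1 - q) = -(p - q) by ring, abs_neg]
  ring

/-- A lower bound for the relative entropy of two Bernoulli distributions. -/
theorem devRate_le_kl {q p : ℝ} (hq : 0 ≤ q) (hqp : q < p) (hp : p < 1) :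
    devRate q p ≤ q * Real.log (q / p) + (1 - q) * Real.log ((1 - q) / (1 - p)) := by
  set W := q * (1 - q) + (p - q) with hW
  have hW0 : 0 < W := by nlinarith
  let g : ℝ → ℝ := fun x => -(q * Real.log x) - (1 - q) * Real.log (1 - x) - (x - q) ^ 2 / (2 * W)
  have hder : ∀ x ∈ Set.Ioo q p,
      HasDerivAt g (-(q * x⁻¹) - (1 - q) * (-1 / (1 - x)) - 2 * (x - q) / (2 * W)) x := by
    intro x hx
    have hx0 : x ≠ 0 := (hq.trans_lt hx.1).ne'
    have hx1 : 1 - x ≠ 0 := by linarith [hx.2]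
    have h1 := ((Real.hasDerivAt_log hx0).const_mul q).neg
    have h2 := (((hasDerivAt_id x).const_sub 1).log hx1).const_mul (1 - q)
    have h3 := (((hasDerivAt_id x).sub_const q).pow 2).div_const (2 * W)
    refine ((h1.sub h2).sub h3).congr_deriv ?_
    simp
  have hcont : ContinuousOn g (Set.Icc q p) := by
    have h1 : ContinuousOn (fun x => q * Real.log x) (Set.Icc q p) := by
      -- For q = 0 the term q log x vanishes identically, so the singularity of the logarithm at 0
      -- is harmless.
      rcases hq.eq_or_lt with rfl | hq0
      · simpa using continuousOn_const
      · refine continuousOn_const.mul (Real.continuousOn_log.mono fun x hx => ?_)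
        exact (hq0.trans_le hx.1).ne'
    have h2 : ContinuousOn (fun x => (1 - q) * Real.log (1 - x)) (Set.Icc q p) := by
      refine continuousOn_const.mul (ContinuousOn.log (by fun_prop) fun x hx => ?_)
      linarith [hx.2]
    exact (h1.neg.sub h2).sub (by fun_prop)
  have hmono : MonotoneOn g (Set.Icc q p) := by
    refine monotoneOn_of_hasDerivWithinAt_nonneg (convex_Icc q p) hcont
      (fun x hx => (hder x (by simpa using hx)).hasDerivWithinAt) fun x hx => ?_
    rw [interior_Icc] at hx
    have hx0 : 0 < x := hq.trans_lt hx.1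
    have hx1 : 0 < 1 - x := by linarith [hx.2]
    -- x(1-x) - q(1-q) = (x-q)(1-x-q) ≤ p - q on this interval.
    have hxW : x * (1 - x) ≤ W := by nlinarith [hx.1, hx.2]
    have : -(q * x⁻¹) - (1 - q) * (-1 / (1 - x)) - 2 * (x - q) / (2 * W) =
        (x - q) / (x * (1 - x)) - (x - q) / W := by field_simp; ring
    rw [this, sub_nonneg]
    exact div_le_div_of_nonneg_left (by linarith [hx.1]) (by positivity) hxW
  have hle := hmono (Set.left_mem_Icc.2 hqp.le) (Set.right_mem_Icc.2 hqp.le) hqp.le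
  have hp0 : 0 < p := hq.trans_lt hqp
  have e1 : q * Real.log (q / p) = q * Real.log q - q * Real.log p := by
    rcases hq.eq_or_lt with rfl | hq0
    · simp
    · rw [Real.log_div hq0.ne' hp0.ne']; ring
  have e2 : Real.log ((1 - q) / (1 - p)) = Real.log (1 - q) - Real.log (1 - p) :=
    Real.log_div (by linarith) (by linarith)
  have e3 : devRate q p = (p - q) ^ 2 / (2 * W) := by
    rw [devRate, abs_of_pos (by linarith)]
  rw [e1, e2, e3]
  simp only [g, sub_self] at hle
  norm_num at hle
  linarith

section
variable {X : Type*} [Countable X] [MeasurableSpace X] [MeasurableSingletonClass X]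
  (μ : Measure X) [IsProbabilityMeasure μ]

/-- The integrand is a product of independent factors, each equal to u on C and 1 off C. -/
theorem integral_pow_hitCount (C : Set X) (N : ℕ) (u : ℝ) :
    ∫ x : Fin N → X, u ^ hitCount C x ∂(Measure.pi fun _ => μ) =
      (1 - μ.real C + μ.real C * u) ^ N := by
  classical
  have hC : MeasurableSet C := C.to_countable.measurableSet
  have h1 : ∀ x : Fin N → X, u ^ hitCount C x =
      ∏ j, (C.indicator (fun _ => u - 1) (x j) + 1) := by
    intro x
    have : ∀ j, C.indicator (fun _ => u - 1) (x j) + 1 = if x j ∈ C then u else 1 := by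
      intro j; by_cases h : x j ∈ C <;> simp [h]
    simp_rw [this]
    rw [Finset.prod_ite]
    simp [hitCount]
  simp_rw [h1]
  rw [integral_fintype_prod_eq_pow (ι := Fin N) (fun y : X => C.indicator (fun _ => u - 1) y + 1),
    Fintype.card_fin, integral_add ((integrable_const _).indicator hC) (integrable_const _),
    integral_indicator_const _ hC]
  simp
  ring

theorem measureReal_hitCount_le_mul (C : Set X) {N : ℕ} (m : ℕ) {u : ℝ} (hu : 0 ≤ u)
    (hu1 : u ≤ 1) :
    u ^ m * (Measure.pi fun _ : Fin N => μ).real {x | hitCount C x ≤ m} ≤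
      (1 - μ.real C + μ.real C * u) ^ N := by
  rw [← integral_pow_hitCount]
  have hint : Integrable (fun x : Fin N → X => u ^ hitCount C x) (Measure.pi fun _ => μ) := by
    refine Integrable.of_bound (measurable_of_countable _).aestronglyMeasurable 1 ?_
    refine Filter.Eventually.of_forall fun x => ?_
    rw [Real.norm_of_nonneg (by positivity)]
    exact pow_le_one₀ hu hu1
  refine le_trans ?_ (mul_meas_ge_le_integral_of_nonneg
    (Filter.Eventually.of_forall fun x => by positivity) hint (u ^ m))
  gcongr
  · finiteness
  intro hx
  exact pow_le_pow_of_le_one hu hu1 hx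

/-- Lower tail of the binomial distribution. -/
theorem measureReal_hitCount_le (C : Set X) {N m : ℕ} (hN : 0 < N)
    (hm : (m : ℝ) / N < μ.real C) :
    (Measure.pi fun _ : Fin N => μ).real {x | hitCount C x ≤ m} ≤
      Real.exp (-(N * devRate (m / N) (μ.real C))) := by
  set p := μ.real C with hp
  set q : ℝ := m / N with hq
  set π := (Measure.pi fun _ : Fin N => μ).real {x | hitCount C x ≤ m} with hπ
  have hN0 : (0 : ℝ) < N := by exact_mod_cast hN
  have hq0 : 0 ≤ q := by positivity
  have hp1 : p ≤ 1 := measureReal_le_one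
  have hmN : (m : ℝ) = q * N := by rw [hq]; field_simp
  -- For p = 1 the optimal tilt degenerates to 0. Taking u = exp(-N·rate) suffices, since the moment
  -- is u^N and m < N.
  rcases hp1.eq_or_lt with hp1 | hp1
  · have hr : 0 ≤ devRate q p := by
      unfold devRate
      have : 0 ≤ q * (1 - q) := mul_nonneg hq0 (by linarith)
      positivity
    set u := Real.exp (-(N * devRate q p)) with hu
    have hu1 : u ≤ 1 := Real.exp_le_one_iff.2 (by have := mul_nonneg hN0.le hr; linarith)
    have hu0 : 0 < u := Real.exp_pos _
    have h := measureReal_hitCount_le_mul μ C (N := N) m hu0.le hu1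
    rw [← hp, ← hπ, hp1] at h
    have hlt : m < N := by
      rw [hp1, hq, div_lt_one hN0] at hm
      exact_mod_cast hm
    obtain ⟨e, rfl⟩ := Nat.exists_eq_add_of_lt hlt
    have h2 : u ^ (m + e + 1) ≤ u ^ m * u := by
      rw [← pow_succ]
      exact pow_le_pow_of_le_one hu0.le hu1 (by omega)
    have h3 : u ^ m * π ≤ u ^ m * u := by
      refine h.trans (le_trans (le_of_eq ?_) h2)
      ring
    exact le_of_mul_le_mul_left h3 (by positivity)
  · have hq1 : 0 < 1 - q := by linarith
    have hp1' : 0 < 1 - p := by linarith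
    have hp0 : 0 < p := hq0.trans_lt hm
    set w := (1 - p) / (1 - q) with hw
    have hw0 : 0 < w := by positivity
    -- This is the optimal Chernoff tilt q(1-p)/(p(1-q)). It collapses the moment to w^N and yields
    -- the relative entropy as exponent.
    have h := measureReal_hitCount_le_mul μ C (N := N) m (u := q / p * w) (by positivity) (by
      rw [hw, div_mul_div_comm, div_le_one (by positivity)]
      nlinarith)
    have e1 : 1 - p + p * (q / p * w) = w := by
      rw [hw]; field_simp; ring
    rw [← hp, ← hπ, e1] at h
    have hkl := devRate_le_kl hq0 hm hp1
    have hlogw : Real.log ((1 - q) / (1 - p)) = -Real.log w := by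
      rw [hw, ← Real.log_inv, inv_div]
    rw [hlogw] at hkl
    have hπ0 : 0 ≤ π := measureReal_nonneg
    rcases hπ0.eq_or_lt with hz | hπ0
    · rw [← hz]; positivity
    rw [← Real.log_le_iff_le_exp hπ0]
    have hkey : m * Real.log (q / p) + m * Real.log w + Real.log π ≤ N * Real.log w := by
      rcases Nat.eq_zero_or_pos m with rfl | hm0
      · simp only [pow_zero, one_mul] at h
        have := Real.log_le_log hπ0 h
        rw [Real.log_pow] at this
        simpa using this
      · have hq0' : 0 < q := by positivity
        have := Real.log_le_log (by positivity) h
        rw [Real.log_mul (by positivity) hπ0.ne', Real.log_pow, Real.log_pow,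
          Real.log_mul (by positivity) hw0.ne'] at this
        linarith
    rw [hmN] at hkey
    have := mul_le_mul_of_nonneg_left hkl hN0.le
    linarith

end

/-- The empirical Bernstein error bounds the deviation outside an event of large rate. -/
theorem le_devRate_of_bernstein {q p V a : ℝ} (ha : 0 < a) (hq : 0 ≤ q) (hq1 : q ≤ 1)
    (hV : q * (1 - q) ≤ V) (h : √(2 * V * a) + 7 * a / 3 ≤ |p - q|) : a ≤ devRate q p := by
  set t := |p - q| with ht
  set s := √(2 * (q * (1 - q)) * a) with hs
  have hv : 0 ≤ q * (1 - q) := mul_nonneg hq (by linarith)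
  have hs0 : 0 ≤ s := Real.sqrt_nonneg _
  have hs2 : s ^ 2 = 2 * (q * (1 - q)) * a := Real.sq_sqrt (by positivity)
  have hsV : s ≤ √(2 * V * a) := Real.sqrt_le_sqrt (by gcongr)
  -- Only 2 of the 7/3 is needed: t² ≥ t(s + 2a) ≥ s² + 2at = 2a(q(1-q) + t).
  have hts : s + 2 * a ≤ t := by linarith
  have ht0 : 0 < t := by linarith
  rw [devRate, ← ht, ← sq_abs (p - q), ← ht, le_div_iff₀ (by positivity)]
  nlinarith

/-! ### p-values, symmetrization and uniform deviations -/

/-- Exchange of the members of those pairs whose sign is negative. -/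
def pairSwap {X : Type*} {N : ℕ} (σ : Fin N → Bool) (z : (Fin N → X) × (Fin N → X)) :
    (Fin N → X) × (Fin N → X) :=
  (fun j => if σ j then z.1 j else z.2 j, fun j => if σ j then z.2 j else z.1 j)

theorem pairSwap_pairSwap {X : Type*} {N : ℕ} (σ : Fin N → Bool) (z : (Fin N → X) × (Fin N → X)) :
    pairSwap σ (pairSwap σ z) = z := by
  ext j <;> by_cases h : σ j <;> simp [pairSwap, h]

/-- The set of those positions of a double sample at which `C` is hit. -/
noncomputable def hitSet {X : Type*} {N : ℕ} (z : (Fin N → X) × (Fin N → X)) (C : Set X) :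
    Finset (Fin N × Bool) := by
  classical exact Finset.univ.filter fun j => (if j.2 then z.1 j.1 else z.2 j.1) ∈ C

theorem hitCount_pairSwap_sub {X : Type*} {N : ℕ} (σ : Fin N → Bool) (z : (Fin N → X) × (Fin N → X))
    (C : Set X) :
    (hitCount C (pairSwap σ z).1 : ℝ) - hitCount C (pairSwap σ z).2 =
      signedDiff σ (hitSet z C) := by
  classical
  have h : ∀ x : Fin N → X, (hitCount C x : ℝ) = ∑ j, if x j ∈ C then 1 else 0 := by
    intro x; simp [hitCount]
  rw [h, h, ← Finset.sum_sub_distrib, signedDiff]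
  refine Finset.sum_congr rfl fun j _ => ?_
  by_cases hj : σ j <;> simp [pairSwap, hj, boolSign, pairDiff, hitSet]

section
variable {X : Type*} [Countable X] [MeasurableSpace X] [MeasurableSingletonClass X]
  (μ : Measure X) [IsProbabilityMeasure μ]

/-- The event lies in the lower tail cut at its largest admissible count, and that count itself
satisfies the rate condition. Monotonicity of the rate is therefore not needed. -/
theorem measureReal_lower_rate_le (C : Set X) {N : ℕ} (hN : 0 < N) {y : ℝ} (hy : 0 ≤ y) :
    (Measure.pi fun _ : Fin N => μ).real {x | (hitCount C x : ℝ) / N < μ.real C ∧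
      Real.exp (-(N * devRate (hitCount C x / N) (μ.real C))) ≤ y} ≤ y := by
  classical
  let S := (Finset.range (N + 1)).filter fun m : ℕ => (m : ℝ) / N < μ.real C ∧
      Real.exp (-(N * devRate (m / N) (μ.real C))) ≤ y
  have hmem : ∀ x : Fin N → X, ((hitCount C x : ℝ) / N < μ.real C ∧
      Real.exp (-(N * devRate (hitCount C x / N) (μ.real C))) ≤ y) → hitCount C x ∈ S := by
    intro x hx
    simp only [S, Finset.mem_filter, Finset.mem_range]
    exact ⟨Nat.lt_succ_of_le (hitCount_le C x), hx⟩
  rcases S.eq_empty_or_nonempty with hS | hS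
  · have : {x : Fin N → X | (hitCount C x : ℝ) / N < μ.real C ∧
      Real.exp (-(N * devRate (hitCount C x / N) (μ.real C))) ≤ y} = ∅ := by
      ext x
      simp only [Set.mem_ofPred_eq, Set.mem_empty_iff_false, iff_false]
      intro hx
      have := hmem x hx
      simp [hS] at this
    rw [this]
    simpa using hy
  · have hm := (Finset.mem_filter.1 (S.max'_mem hS)).2
    refine le_trans (measureReal_mono ?_) ((measureReal_hitCount_le μ C hN hm.1).trans hm.2)
    intro x hx
    exact S.le_max' _ (hmem x hx)

/-- The exponential of the rate of the observed deviation is a two-sided p-value. -/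
theorem measureReal_rate_le (C : Set X) {N : ℕ} (hN : 0 < N) {y : ℝ} (hy : 0 ≤ y) :
    (Measure.pi fun _ : Fin N => μ).real {x |
      Real.exp (-(N * devRate (hitCount C x / N) (μ.real C))) ≤ y} ≤ 2 * y := by
  rcases le_or_gt 1 y with hy1 | hy1
  · exact measureReal_le_one.trans (by linarith)
  have hN0 : (0 : ℝ) < N := by exact_mod_cast hN
  have hC : MeasurableSet C := C.to_countable.measurableSet
  have h1 := measureReal_lower_rate_le μ C hN hy
  have h2 := measureReal_lower_rate_le μ Cᶜ hN hy
  refine le_trans (measureReal_mono ?_) ((measureReal_union_le _ _).trans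
    ((add_le_add h1 h2).trans (by linarith)))
  intro x hx
  have e : (hitCount Cᶜ x : ℝ) / N = 1 - hitCount C x / N := by
    rw [hitCount_compl, sub_div, div_self hN0.ne']
  have e2 : μ.real Cᶜ = 1 - μ.real C := probReal_compl_eq_one_sub hC
  simp only [Set.mem_union, Set.mem_ofPred_eq, e, e2, devRate_one_sub]
  rcases lt_trichotomy ((hitCount C x : ℝ) / N) (μ.real C) with h | h | h
  · exact Or.inl ⟨h, hx⟩
  -- An exact match has rate 0 and p-value 1, which exceeds y.
  · exfalso
    simp only [Set.mem_ofPred_eq, h, devRate] at hx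
    simp at hx
    linarith
  · exact Or.inr ⟨by linarith, hx⟩

/-- A sufficiently long sample deviates with probability at most one half. -/
theorem measureReal_dev_le_half (C : Set X) {N : ℕ} (hN : 0 < N) {ε : ℝ} (hε : 0 < ε)
    (hNε : 14 ≤ N * ε ^ 2) :
    (Measure.pi fun _ : Fin N => μ).real
      {x | ε / 2 ≤ |(hitCount C x : ℝ) / N - μ.real C|} ≤ 1 / 2 := by
  refine le_trans (measureReal_mono ?_)
    ((measureReal_rate_le μ C hN (y := 1 / 4) (by norm_num)).trans (by norm_num))
  intro x hx
  have hN0 : (0 : ℝ) < N := by exact_mod_cast hN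
  simp only [Set.mem_ofPred_eq] at hx ⊢
  set q : ℝ := hitCount C x / N with hq
  set p := μ.real C with hp
  have hq0 : 0 ≤ q := by positivity
  have hq1 : q ≤ 1 := by
    rw [hq, div_le_one hN0]; exact_mod_cast hitCount_le C x
  have hp0 : 0 ≤ p := measureReal_nonneg
  have hp1 : p ≤ 1 := measureReal_le_one
  rw [abs_sub_comm] at hx
  have ht1 : |p - q| ≤ 1 := abs_le.2 ⟨by linarith, by linarith⟩
  have ht0 : 0 < |p - q| := by linarith
  have hv : 0 ≤ q * (1 - q) := mul_nonneg hq0 (by linarith)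
  have hv4 : q * (1 - q) ≤ 1 / 4 := by nlinarith [sq_nonneg (q - 1 / 2)]
  -- From q(1-q) ≤ 1/4 and |p-q| ≤ 1 the denominator is at most 5/2. Then 14/10 exceeds log 4,
  -- giving the p-value 1/4.
  have hr : ε ^ 2 / 10 ≤ devRate q p := by
    rw [devRate, ← sq_abs (p - q), le_div_iff₀ (by positivity)]
    have h1 : (ε / 2) ^ 2 ≤ |p - q| ^ 2 := by gcongr
    have h2 : 2 * (q * (1 - q) + |p - q|) ≤ 5 / 2 := by linarith
    calc ε ^ 2 / 10 * (2 * (q * (1 - q) + |p - q|)) ≤ ε ^ 2 / 10 * (5 / 2) := by gcongr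
      _ ≤ _ := by linarith
  have h3 : 1.4 ≤ N * devRate q p := by
    calc (1.4 : ℝ) ≤ N * (ε ^ 2 / 10) := by linarith
      _ ≤ _ := by gcongr
  have h4 : Real.log 4 = 2 * Real.log 2 := by
    rw [show (4 : ℝ) = 2 ^ 2 by norm_num, Real.log_pow]; norm_num
  rw [← Real.le_log_iff_exp_le (by norm_num), one_div, Real.log_inv, h4]
  linarith [Real.log_two_lt_d9]

/-- On a countable space singletons determine the measure, and a swap only permutes the factors of a
singleton's mass. -/
theorem map_pairSwap {N : ℕ} (σ : Fin N → Bool) :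
    ((Measure.pi fun _ : Fin N => μ).prod (Measure.pi fun _ : Fin N => μ)).map (pairSwap σ) =
      (Measure.pi fun _ : Fin N => μ).prod (Measure.pi fun _ : Fin N => μ) := by
  have hs : ∀ z : (Fin N → X) × (Fin N → X),
      ((Measure.pi fun _ : Fin N => μ).prod (Measure.pi fun _ : Fin N => μ)) {z} =
        ∏ j, μ {z.1 j} * μ {z.2 j} := by
    intro z
    rw [← Prod.mk.eta (p := z), ← Set.singleton_prod_singleton, Measure.prod_prod,
      Measure.pi_singleton, Measure.pi_singleton, Finset.prod_mul_distrib]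
  refine Measure.ext_of_singleton fun z => ?_
  rw [Measure.map_apply (measurable_of_countable _) (measurableSet_singleton z)]
  have : pairSwap σ ⁻¹' {z} = {pairSwap σ z} := by
    ext w
    simp only [Set.mem_preimage, Set.mem_singleton_iff]
    constructor
    · rintro rfl; rw [pairSwap_pairSwap]
    · rintro rfl; rw [pairSwap_pairSwap]
  rw [this, hs, hs]
  refine Finset.prod_congr rfl fun j _ => ?_
  by_cases h : σ j <;> simp [pairSwap, h, mul_comm]

/-- Uniform deviation bound for a double sample. -/
theorem measureReal_double_sample_le {ι : Type*} [Finite ι] (C : ι → Set X) {N : ℕ} (hN : 0 < N)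
    {d : ℕ} (hd1 : 1 ≤ d)
    (hd : ∀ (z : (Fin N → X) × (Fin N → X)) (𝒜 : Finset (Finset (Fin N × Bool))),
      (∀ A ∈ 𝒜, ∃ i, A = hitSet z (C i)) → 𝒜.vcDim ≤ d)
    {η Q : ℝ} (hη : 0 < η) (hQ : 1 ≤ Q) (hbig : 6 * d + Q ≤ N * η ^ 2 / 512) :
    ((Measure.pi fun _ : Fin N => μ).prod (Measure.pi fun _ : Fin N => μ)).real
      {z | ∃ i, N * η ≤ |(hitCount (C i) z.1 : ℝ) - hitCount (C i) z.2|} ≤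
      4 * Real.exp (-Q) := by
  classical
  have := Fintype.ofFinite ι
  set ρ := (Measure.pi fun _ : Fin N => μ).prod (Measure.pi fun _ : Fin N => μ) with hρ
  set B := {z : (Fin N → X) × (Fin N → X) |
    ∃ i, N * η ≤ |(hitCount (C i) z.1 : ℝ) - hitCount (C i) z.2|} with hB
  have hmeas : ∀ S : Set ((Fin N → X) × (Fin N → X)), MeasurableSet S :=
    fun S => S.to_countable.measurableSet
  have h1 : ∀ σ : Fin N → Bool, ρ.real B = ∫ z, (pairSwap σ ⁻¹' B).indicator 1 z ∂ρ := by
    intro σ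
    rw [integral_indicator_one (hmeas _), ← map_measureReal_apply (measurable_of_countable _)
      (hmeas _), map_pairSwap]
  -- Averaging over all swaps leaves, for each fixed double sample, a count of bad sign vectors.
  have h2 : (2 : ℝ) ^ N * ρ.real B = ∑ σ : Fin N → Bool,
      ∫ z, (pairSwap σ ⁻¹' B).indicator (1 : (Fin N → X) × (Fin N → X) → ℝ) z ∂ρ := by
    rw [← Finset.sum_congr rfl fun σ _ => h1 σ]
    simp
  have hint : ∀ σ : Fin N → Bool, Integrable ((pairSwap σ ⁻¹' B).indicator (1 : (Fin N → X) × (Fin N → X) → ℝ)) ρ :=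
    fun σ => (integrable_const (1 : ℝ)).indicator (hmeas _)
  rw [← integral_finsetSum _ fun σ _ => hint σ] at h2
  have h3 : ∀ z, ∑ σ : Fin N → Bool, (pairSwap σ ⁻¹' B).indicator (1 : (Fin N → X) × (Fin N → X) → ℝ) z ≤
      2 ^ N * (4 * Real.exp (-Q)) := by
    intro z
    have hc := card_signs_exists_le hN (Finset.univ.image fun i => hitSet z (C i))
      (hd z _ fun A hA => by
        obtain ⟨i, -, rfl⟩ := Finset.mem_image.1 hA
        exact ⟨i, rfl⟩) hd1 hη hQ hbig
    refine le_trans (le_of_eq ?_) hc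
    rw [Finset.card_filter]
    push_cast
    refine Finset.sum_congr rfl fun σ _ => ?_
    simp only [Set.indicator_apply, Set.mem_preimage, hB, Set.mem_ofPred_eq, Pi.one_apply,
      hitCount_pairSwap_sub, Finset.mem_image, Finset.mem_univ, true_and, exists_exists_eq_and]
  have h4 : ∫ z, ∑ σ : Fin N → Bool, (pairSwap σ ⁻¹' B).indicator (1 : (Fin N → X) × (Fin N → X) → ℝ) z ∂ρ ≤
      2 ^ N * (4 * Real.exp (-Q)) := by
    refine (integral_mono (integrable_finsetSum _ fun σ _ => hint σ)
      (integrable_const _) h3).trans ?_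
    simp
  rw [← h2] at h4
  exact le_of_mul_le_mul_left h4 (by positivity)

/-- Uniform deviation bound for a family of sets of bounded VC-dimension. -/
theorem measureReal_uniform_dev_le {ι : Type*} [Finite ι] (C : ι → Set X) {N : ℕ} (hN : 0 < N)
    {d : ℕ} (hd1 : 1 ≤ d)
    (hd : ∀ (z : (Fin N → X) × (Fin N → X)) (𝒜 : Finset (Finset (Fin N × Bool))),
      (∀ A ∈ 𝒜, ∃ i, A = hitSet z (C i)) → 𝒜.vcDim ≤ d)
    {ε Q : ℝ} (hε : 0 < ε) (hQ : 1 ≤ Q) (hbig : 6 * d + Q ≤ N * ε ^ 2 / 2048) :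
    (Measure.pi fun _ : Fin N => μ).real
      {x | ∃ i, ε ≤ |(hitCount (C i) x : ℝ) / N - μ.real (C i)|} ≤ 8 * Real.exp (-Q) := by
  have hN0 : (0 : ℝ) < N := by exact_mod_cast hN
  have h := measureReal_double_sample_le μ C hN hd1 hd (η := ε / 2) (by positivity) hQ
    (by linarith)
  set ν := Measure.pi fun _ : Fin N => μ with hν
  set B := {z : (Fin N → X) × (Fin N → X) |
    ∃ i, N * (ε / 2) ≤ |(hitCount (C i) z.1 : ℝ) - hitCount (C i) z.2|} with hB
  set A := {x : Fin N → X | ∃ i, ε ≤ |(hitCount (C i) x : ℝ) / N - μ.real (C i)|} with hA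
  have hmeasB : MeasurableSet B := B.to_countable.measurableSet
  have hmeasA : MeasurableSet A := A.to_countable.measurableSet
  -- At least half of all ghost samples are accurate to ε/2 for the set that witnesses x ∈ A, so
  -- they differ from x by at least ε/2 there. This doubles the final bound.
  have hfib : ∀ x ∈ A, (1 / 2 : ℝ) ≤ ν.real (Prod.mk x ⁻¹' B) := by
    rintro x ⟨i, hi⟩
    have hhalf := measureReal_dev_le_half μ (C i) hN hε (by
      have : (1 : ℝ) ≤ d := by exact_mod_cast hd1
      linarith)
    set G := {x | ε / 2 ≤ |(hitCount (C i) x : ℝ) / N - μ.real (C i)|} with hG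
    have hGc : ν.real Gᶜ = 1 - ν.real G := probReal_compl_eq_one_sub G.to_countable.measurableSet
    have hsub : Gᶜ ⊆ Prod.mk x ⁻¹' B := by
      intro x' hx'
      simp only [hG, Set.mem_compl_iff, Set.mem_ofPred_eq, not_le] at hx'
      refine ⟨i, ?_⟩
      have h1 := abs_sub_abs_le_abs_sub ((hitCount (C i) x : ℝ) / N - μ.real (C i))
        ((hitCount (C i) x' : ℝ) / N - μ.real (C i))
      have h2 : ε / 2 ≤ |((hitCount (C i) x : ℝ) - hitCount (C i) x') / N| := by
        rw [sub_div]
        refine le_trans ?_ (h1.trans (le_of_eq ?_))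
        · linarith
        · congr 1; ring
      rw [abs_div, abs_of_pos hN0, le_div_iff₀ hN0] at h2
      linarith
    have := measureReal_mono (μ := ν) hsub
    linarith
  have hprod : ν A * ENNReal.ofReal (1 / 2) ≤ (ν.prod ν) B := by
    rw [Measure.prod_apply hmeasB, mul_comm, ← lintegral_indicator_const hmeasA]
    refine lintegral_mono fun x => ?_
    by_cases hx : x ∈ A
    · rw [Set.indicator_of_mem hx]
      refine (ENNReal.ofReal_le_ofReal (hfib x hx)).trans ?_
      rw [ofReal_measureReal]
    · simp [hx]
  have hreal := ENNReal.toReal_mono (measure_ne_top _ _) hprod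
  rw [ENNReal.toReal_mul, ENNReal.toReal_ofReal (by norm_num)] at hreal
  change ν.real A * (1 / 2) ≤ (ν.prod ν).real B at hreal
  linarith

end

/-! ### Error sets and the VC-dimension of the hypotheses -/

/-- The set of the samples on which the hypothesis `g` errs. -/
def errorSet {X Y : Type*} (f g : X → Y) : Set X := {x | g x ≠ f x}

theorem loss_eq_indicator {X Y : Type*} (f g : X → Y) (x : X) :
    loss (g x) (f x) = (errorSet f g).indicator 1 x := by
  classical
  by_cases h : g x = f x <;> simp [loss, errorSet, h]

theorem eq_of_ne_iff_ne {Y : Type*} (hY : Nat.card Y = 2) {a b c : Y}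
    (h : a ≠ c ↔ b ≠ c) : a = b := by
  classical
  have := Nat.finite_of_card_ne_zero (by omega : Nat.card Y ≠ 0)
  have := Fintype.ofFinite Y
  by_contra hab
  have hac : a ≠ c := fun hac => (h.not.1 (not_not.2 hac)) fun hbc => hab (hac.trans hbc.symm)
  have hbc := h.1 hac
  have h3 : ({a, b, c} : Finset Y).card = 3 := Finset.card_eq_three.2 ⟨a, b, c, hab, hac, hbc, rfl⟩
  have := Finset.card_le_univ ({a, b, c} : Finset Y)
  rw [Nat.card_eq_fintype_card] at hY
  omega

/-- The 2^|S| labellings need distinct indices. This boundedness keeps the `sSup` in `vcDim` from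
taking its default value. -/
theorem card_le_of_shatters {X Y : Type*} (hY : Nat.card Y = 2) {k : ℕ} (h : Fin k → X → Y)
    {S : Finset X} (hS : Shatters (Set.range h) S) : S.card ≤ k := by
  choose! H hH hHS using hS
  choose i hi using hH
  have hinj : Function.Injective i := fun g g' hgg => by
    funext x
    rw [← hHS g x, ← hHS g' x, ← hi g, ← hi g', hgg]
  have := Nat.finite_of_card_ne_zero (by omega : Nat.card Y ≠ 0)
  have hc := Nat.card_le_card_of_injective i hinj
  rw [Nat.card_fun, hY] at hc
  simp only [Nat.card_eq_fintype_card, Fintype.card_coe, Fintype.card_fin] at hc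
  exact (Nat.lt_two_pow_self).le.trans hc

theorem card_le_vcDim {X Y : Type*} (hY : Nat.card Y = 2) {k : ℕ} (h : Fin k → X → Y)
    {S : Finset X} (hS : Shatters (Set.range h) S) : S.card ≤ vcDim (Set.range h) := by
  refine le_csSup ⟨k, ?_⟩ ⟨S, rfl, hS⟩
  rintro w ⟨S', rfl, hS'⟩
  exact card_le_of_shatters hY h hS'

/-- A point where two hypotheses differ is shattered. The packing bound needs d ≥ 1 to absorb
additive constants. -/
theorem one_le_vcDim {X Y : Type*} (hY : Nat.card Y = 2) {k : ℕ} (h : Fin k → X → Y)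
    (hne : ∃ i j, h i ≠ h j) : 1 ≤ vcDim (Set.range h) := by
  obtain ⟨i, j, hij⟩ := hne
  obtain ⟨x, hx⟩ := Function.ne_iff.1 hij
  have : Shatters (Set.range h) {x} := by
    intro g
    by_cases hg : h i x = g ⟨x, by simp⟩
    · refine ⟨h i, ⟨i, rfl⟩, ?_⟩
      rintro ⟨y, hy⟩
      obtain rfl := Finset.mem_singleton.1 hy
      exact hg
    · refine ⟨h j, ⟨j, rfl⟩, ?_⟩
      rintro ⟨y, hy⟩
      obtain rfl := Finset.mem_singleton.1 hy
      exact eq_of_ne_iff_ne hY (c := h i y) ⟨fun _ => Ne.symm hg, fun _ => hx.symm⟩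
  simpa using card_le_vcDim hY h this

theorem mem_hitSet {X : Type*} {N : ℕ} (z : (Fin N → X) × (Fin N → X)) (C : Set X)
    (j : Fin N × Bool) : j ∈ hitSet z C ↔ (if j.2 then z.1 j.1 else z.2 j.1) ∈ C := by
  classical
  unfold hitSet
  rw [Finset.mem_filter]
  simp

open Finset in
/-- The traces of the error sets on a double sample have VC-dimension at most that of the
hypotheses. -/
theorem vcDim_hitSet_le {X Y : Type*} (hY : Nat.card Y = 2) {k : ℕ} (f : X → Y)
    (h : Fin k → X → Y) {N : ℕ} (z : (Fin N → X) × (Fin N → X))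
    (𝒜 : Finset (Finset (Fin N × Bool))) (h𝒜 : ∀ A ∈ 𝒜, ∃ i, A = hitSet z (errorSet f (h i))) :
    𝒜.vcDim ≤ Saphyra.vcDim (Set.range h) := by
  classical
  refine Finset.sup_le fun s hs => ?_
  rw [mem_shatterer] at hs
  let y : Fin N × Bool → X := fun j => if j.2 then z.1 j.1 else z.2 j.1
  have hsh : ∀ t ⊆ s, ∃ i, ∀ a ∈ s, h i (y a) ≠ f (y a) ↔ a ∈ t := by
    intro t ht
    obtain ⟨u, hu, hut⟩ := hs ht
    obtain ⟨i, rfl⟩ := h𝒜 u hu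
    refine ⟨i, fun a ha => ?_⟩
    rw [← hut]
    simp [ha, mem_hitSet, errorSet, y]
  have hinj : Set.InjOn y s := by
    intro a ha b hb hab
    obtain ⟨i, hi⟩ := hsh {a} (by simpa using ha)
    have h1 := hi a ha
    have h2 := hi b hb
    rw [hab] at h1
    have h3 : b ∈ ({a} : Finset _) := (h2.symm.trans h1).2 (by simp)
    exact (mem_singleton.1 h3).symm
  rw [← card_image_of_injOn hinj]
  refine card_le_vcDim hY h fun g => ?_
  -- With two labels a labelling is determined by where it disagrees with f, so the error pattern of
  -- g is requested.
  obtain ⟨i, hi⟩ := hsh (s.filter fun a => ∃ ha : y a ∈ s.image y, g ⟨y a, ha⟩ ≠ f (y a))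
    (filter_subset _ _)
  refine ⟨h i, ⟨i, rfl⟩, ?_⟩
  rintro ⟨x, hx⟩
  obtain ⟨a, ha, rfl⟩ := mem_image.1 hx
  refine eq_of_ne_iff_ne hY (c := f (y a)) ((hi a ha).trans ?_)
  simp only [mem_filter, ha, true_and]
  exact ⟨fun ⟨_, h⟩ => h, fun h => ⟨hx, h⟩⟩

/-! ### The doubling loop, sample statistics and the risk decomposition -/

/-- The loop stops at one of the doubled sizes, and it halts unless all rounds are used up. -/
theorem loop_spec (halt : ℕ → Prop) (Nmax : ℕ) (r N : ℕ) (hN : N ≤ Nmax) :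
    ∃ s ≤ r, loop halt Nmax r N = min (2 ^ s * N) Nmax ∧
      (s < r → halt (min (2 ^ s * N) Nmax)) := by
  classical
  induction r generalizing N with
  | zero => exact ⟨0, le_rfl, by simp [loop, hN], by simp⟩
  | succ r ih =>
    by_cases hh : halt N
    · exact ⟨0, by omega, by simp [loop, hh, hN], by simp [hN, hh]⟩
    · obtain ⟨s, hs, h1, h2⟩ := ih (min (2 * N) Nmax) (min_le_right _ _)
      have e : min (2 ^ s * min (2 * N) Nmax) Nmax = min (2 ^ (s + 1) * N) Nmax := by
        have h3 : Nmax ≤ 2 ^ s * Nmax := Nat.le_mul_of_pos_left _ (by positivity)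
        rw [← Nat.mul_min_mul_left, min_assoc, min_eq_right h3, pow_succ, mul_assoc]
      rw [e] at h1 h2
      exact ⟨s + 1, by omega, by simp [loop, hh, h1], fun h => h2 (by omega)⟩

theorem sampleMean_loss {X Y : Type*} (f g : X → Y) (x : ℕ → X) (N : ℕ) :
    sampleMean N (fun j => loss (g (x j)) (f (x j))) =
      (hitCount (errorSet f g) (fun j : Fin N => x j) : ℝ) / N := by
  classical
  simp only [sampleMean, loss_eq_indicator, ← Fin.sum_univ_eq_sum_range
    (fun j => (errorSet f g).indicator (1 : X → ℝ) (x j))]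
  rw [one_div_mul_eq_div]
  congr 1
  simp [hitCount, Set.indicator_apply]

theorem sum_sum_sub_sq (z : ℕ → ℝ) (N : ℕ) :
    ∑ j ∈ Finset.range N, ∑ i ∈ Finset.range j, (z i - z j) ^ 2 =
      N * ∑ j ∈ Finset.range N, z j ^ 2 - (∑ j ∈ Finset.range N, z j) ^ 2 := by
  induction N with
  | zero => simp
  | succ N ih =>
    have h : ∑ i ∈ Finset.range N, (z i - z N) ^ 2 = ∑ i ∈ Finset.range N, z i ^ 2 -
        2 * z N * ∑ i ∈ Finset.range N, z i + N * z N ^ 2 := by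
      simp only [sub_sq, Finset.sum_add_distrib, Finset.sum_sub_distrib, Finset.mul_sum]
      simp
      exact Finset.sum_congr rfl fun _ _ => by ring
    simp only [Finset.sum_range_succ _ N]
    rw [ih, h]
    push_cast
    ring

/-- The sample variance of a 0-1 sequence dominates the variance of the empirical distribution. -/
theorem mean_mul_one_sub_le_sampleVar {z : ℕ → ℝ} (hz : ∀ j, z j ^ 2 = z j) {N : ℕ} (hN : 0 < N) :
    sampleMean N z * (1 - sampleMean N z) ≤ sampleVar N z := by
  have hN0 : (0 : ℝ) < N := by exact_mod_cast hN
  have hD : 0 ≤ ∑ j ∈ Finset.range N, ∑ i ∈ Finset.range j, (z i - z j) ^ 2 := by positivity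
  have e := sum_sum_sub_sq z N
  simp_rw [hz] at e
  set S := ∑ j ∈ Finset.range N, z j with hS
  set D := ∑ j ∈ Finset.range N, ∑ i ∈ Finset.range j, (z i - z j) ^ 2 with hDdef
  have h1 : sampleMean N z * (1 - sampleMean N z) = D / (N * N) := by
    rw [sampleMean, ← hS, e]; field_simp
  rw [h1, sampleVar, ← hDdef, one_div_mul_eq_div]
  rcases Nat.lt_or_ge 1 N with h | h
  · have : (1 : ℝ) < N := by exact_mod_cast h
    gcongr
    · nlinarith
  -- Here 1/(N(N-1)) is 1/0 = 0, and the double sum is also 0.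
  · obtain rfl : N = 1 := by omega
    simp [hDdef]

section
variable {X Y : Type*}

theorem summable_toReal (D : PMF X) : Summable fun x => (D x).toReal :=
  ENNReal.summable_toReal (by rw [D.tsum_coe]; exact ENNReal.one_ne_top)

theorem mass_add_mass_compl (D : PMF X) (S : Set X) : mass D S + mass D Sᶜ = 1 := by
  rw [mass, mass, (summable_toReal D).tsum_subtype_add_tsum_subtype_compl S,
    ← ENNReal.tsum_toReal_eq fun x => D.apply_ne_top x, D.tsum_coe]
  rfl

/-- The risk splits into the part of the exact subspace and the weighted error probability under
the renormalized distribution. -/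
theorem risk_eq [Countable X] [MeasurableSpace X] [MeasurableSingletonClass X]
    (D : PMF X) (f g : X → Y) (S : Set X) (hS : 0 < mass D Sᶜ)
    (μ : Measure X) [IsProbabilityMeasure μ] (hμ : ∀ x, μ.real {x} = approxProb D S x) :
    risk D f g = riskOn D f S g + mass D Sᶜ * μ.real (errorSet f g) := by
  classical
  have hsum : Summable fun x => (D x).toReal * loss (g x) (f x) := by
    refine Summable.of_nonneg_of_le (fun x => ?_) (fun x => ?_) (summable_toReal D)
    · refine mul_nonneg ENNReal.toReal_nonneg ?_
      rw [loss]; split_ifs <;> norm_num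
    · refine mul_le_of_le_one_right ENNReal.toReal_nonneg ?_
      rw [loss]; split_ifs <;> norm_num
  rw [risk, ← hsum.tsum_subtype_add_tsum_subtype_compl S]
  congr 1
  have hE : MeasurableSet (errorSet f g) := (errorSet f g).to_countable.measurableSet
  rw [← integral_indicator_one hE,
    integral_countable (f := (errorSet f g).indicator (1 : X → ℝ))
      ((integrable_const (1 : ℝ)).indicator hE), ← tsum_mul_left,
    tsum_subtype Sᶜ fun x => (D x).toReal * loss (g x) (f x)]
  refine tsum_congr fun x => ?_
  rw [hμ, ← loss_eq_indicator, approxProb]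
  by_cases hx : x ∈ S
  · simp [hx]
  · simp [hx]
    field_simp [hS.ne']

end

/-! ### Probabilities of the exceptional events -/

/-- A p-value falls below an independent random level with at most the expected probability. -/
theorem measure_le_half_le_lintegral {Ω : Type*} [MeasurableSpace Ω] (P : Measure Ω)
    [IsProbabilityMeasure P] {U T : Ω → ℝ} (hU : Measurable U) (hT : Measurable T)
    (hind : IndepFun U T P) (hT2 : ∀ y, 0 ≤ y → P.real {ω | T ω ≤ y} ≤ 2 * y)
    (hU0 : ∀ ω, 0 ≤ U ω) :
    P {ω | T ω ≤ U ω / 2} ≤ ∫⁻ ω, ENNReal.ofReal (U ω) ∂P := by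
  have hmap := (indepFun_iff_map_prod_eq_prod_map_map hU.aemeasurable hT.aemeasurable).1 hind
  have hS : MeasurableSet {w : ℝ × ℝ | w.2 ≤ w.1 / 2} :=
    measurableSet_le measurable_snd (measurable_fst.div_const 2)
  have := Measure.isProbabilityMeasure_map (μ := P) hT.aemeasurable
  have := Measure.isProbabilityMeasure_map (μ := P) hU.aemeasurable
  have h1 : P {ω | T ω ≤ U ω / 2} =
      (P.map fun ω => (U ω, T ω)) {w : ℝ × ℝ | w.2 ≤ w.1 / 2} := by
    rw [Measure.map_apply (hU.prodMk hT) hS]; rfl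
  rw [h1, hmap, Measure.prod_apply hS, lintegral_map (measurable_measure_prodMk_left hS) hU]
  refine lintegral_mono fun ω => ?_
  rw [Measure.map_apply hT (measurable_prodMk_left hS)]
  -- After Fubini the level is a constant, and the factor 2 of the p-value cancels the halving.
  have h2 := hT2 (U ω / 2) (by have := hU0 ω; positivity)
  rw [mul_div_cancel₀ _ two_ne_zero] at h2
  refine le_trans (le_of_eq ?_) (ENNReal.ofReal_le_ofReal h2)
  rw [ofReal_measureReal]
  rfl

/-- Halting with a wrong estimate is witnessed by the p-value of the observed deviation. -/
theorem exp_devRate_le_of_bernstein {X Y : Type*} (f g : X → Y) (x : ℕ → X) {N : ℕ} (hN : 0 < N)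
    {δ₀ p : ℝ} (hδ₀ : 0 < δ₀) (hδ₁ : δ₀ < 2)
    (h : bernsteinError N δ₀ (sampleVar N fun j => loss (g (x j)) (f (x j))) ≤
      |p - sampleMean N fun j => loss (g (x j)) (f (x j))|) :
    Real.exp (-(N * devRate (hitCount (errorSet f g) (fun j : Fin N => x j) / N) p)) ≤
      δ₀ / 2 := by
  have hN0 : (0 : ℝ) < N := by exact_mod_cast hN
  have hlog : 0 < Real.log (2 / δ₀) := Real.log_pos (by rw [lt_div_iff₀ hδ₀]; linarith)
  have hvar := mean_mul_one_sub_le_sampleVar (z := fun j => loss (g (x j)) (f (x j)))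
    (fun j => by rw [loss]; split_ifs <;> norm_num) hN
  rw [sampleMean_loss] at h hvar
  set q : ℝ := hitCount (errorSet f g) (fun j : Fin N => x j) / N with hq
  set V := sampleVar N fun j => loss (g (x j)) (f (x j)) with hV
  have hq1 : q ≤ 1 := by
    rw [hq, div_le_one hN0]; exact_mod_cast hitCount_le _ _
  have hr := le_devRate_of_bernstein (a := Real.log (2 / δ₀) / N) (by positivity)
    (by positivity) hq1 hvar (p := p) (by
      refine le_trans (le_of_eq ?_) h
      unfold bernsteinError
      congr 1
      · congr 1; field_simp
      · field_simp)
  rw [div_le_iff₀ hN0] at hr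
  calc Real.exp (-(N * devRate q p)) ≤ Real.exp (-Real.log (2 / δ₀)) :=
        Real.exp_le_exp.2 (by linarith)
    _ = δ₀ / 2 := by rw [← Real.log_inv, inv_div, Real.exp_log (by positivity)]

/-- The doubled initial size exceeds the maximum size after all rounds. -/
theorem maxSize_le_two_pow_mul {c ε' δ : ℝ} (hc : 0 < c) (hε : 0 < ε') (hδ : 0 < δ) (hδ1 : δ < 1)
    (d : ℕ) :
    ⌈maxSize c ε' δ d⌉₊ ≤ 2 ^ rounds c ε' δ d * ⌈initSize c ε' δ⌉₊ := by
  have hlog : 0 < Real.log (1 / δ) := Real.log_pos (by rw [lt_div_iff₀ hδ]; linarith)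
  have hi : 0 < initSize c ε' δ := by unfold initSize; positivity
  have hm : 0 < maxSize c ε' δ d := by unfold maxSize; positivity
  rw [Nat.ceil_le]
  push_cast
  have h1 : Real.logb 2 (maxSize c ε' δ d / initSize c ε' δ) ≤ rounds c ε' δ d := Nat.le_ceil _
  rw [Real.logb_le_iff_le_rpow (by norm_num) (by positivity), Real.rpow_natCast,
    div_le_iff₀ hi] at h1
  refine h1.trans ?_
  gcongr
  exact Nat.le_ceil _

section
variable {X : Type*} [Countable X] [MeasurableSpace X] [MeasurableSingletonClass X]
  {Ω : Type*} [MeasurableSpace Ω] {P : Measure Ω} [IsProbabilityMeasure P] {ξ : ℕ → Ω → X}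
  {μ : Measure X}

theorem measureReal_samples (hξ : ∀ n, Measurable (ξ n)) (hind : iIndepFun ξ P)
    (hlaw : ∀ n, P.map (ξ n) = μ) (N : ℕ) (S : Set (Fin N → X)) :
    P.real {ω | (fun j : Fin N => ξ j ω) ∈ S} = (Measure.pi fun _ : Fin N => μ).real S := by
  have h1 := (iIndepFun_iff_map_fun_eq_pi_map (fun j : Fin N => (hξ j).aemeasurable)).1
    (hind.precomp Fin.val_injective)
  simp_rw [hlaw] at h1
  rw [← h1, map_measureReal_apply (measurable_pi_lambda _ fun j => hξ _)
    S.to_countable.measurableSet]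
  rfl

/-- The probability of an empirical Bernstein failure at a random independent level. -/
theorem measure_bernstein_fail_le [IsProbabilityMeasure μ] (hξ : ∀ n, Measurable (ξ n)) (hind : iIndepFun ξ P)
    (hlaw : ∀ n, P.map (ξ n) = μ) (C : Set X) {N : ℕ} (hN : 0 < N) {U : Ω → ℝ}
    (hU : Measurable U) (hUξ : IndepFun U (fun ω n => ξ n ω) P) (hU0 : ∀ ω, 0 < U ω) :
    P {ω | Real.exp (-(N * devRate (hitCount C (fun j : Fin N => ξ j ω) / N) (μ.real C))) ≤
      U ω / 2} ≤ ∫⁻ ω, ENNReal.ofReal (U ω) ∂P := by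
  have hF : Measurable fun x : ℕ → X =>
      Real.exp (-(N * devRate (hitCount C (fun j : Fin N => x j) / N) (μ.real C))) := by
    have h1 : Measurable fun x : Fin N → X =>
        Real.exp (-(N * devRate (hitCount C x / N) (μ.real C))) := measurable_of_countable _
    exact h1.comp (measurable_pi_lambda _ fun j => measurable_pi_apply _)
  have hT := hF.comp (measurable_pi_lambda (fun ω n => ξ n ω) hξ)
  refine measure_le_half_le_lintegral P hU hT (hUξ.comp measurable_id hF) (fun y hy => ?_)
    fun ω => (hU0 ω).le
  have := measureReal_samples hξ hind hlaw N
    {x | Real.exp (-(N * devRate (hitCount C x / N) (μ.real C))) ≤ y}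
  exact this.trans_le (measureReal_rate_le μ C hN hy)

end

/-- Uniform convergence of the empirical errors for a sample of maximum size. -/
theorem measureReal_max_sample_le {X Y : Type*} [Countable X] [MeasurableSpace X]
    [MeasurableSingletonClass X] (μ : Measure X) [IsProbabilityMeasure μ]
    (hY : Nat.card Y = 2) (f : X → Y) {k : ℕ} (h : Fin k → X → Y) (hne : ∃ i j, h i ≠ h j)
    {c ε' δ : ℝ} (hc : 18432 ≤ c) (hε : 0 < ε') (hδ : 0 < δ) (hδ1 : δ < 1) {N : ℕ}
    (hN : maxSize c ε' δ (vcDim (Set.range h)) ≤ N) :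
    (Measure.pi fun _ : Fin N => μ).real
      {x | ∃ i, ε' ≤ |(hitCount (errorSet f (h i)) x : ℝ) / N - μ.real (errorSet f (h i))|} ≤
      δ / 2 := by
  have hd1 := one_le_vcDim hY h hne
  set d := vcDim (Set.range h) with hd
  have hd1' : (1 : ℝ) ≤ d := by exact_mod_cast hd1
  have hlog : 0 < Real.log (1 / δ) := Real.log_pos (by rw [lt_div_iff₀ hδ]; linarith)
  have hNε : 18432 * (d + Real.log (1 / δ)) ≤ N * ε' ^ 2 := by
    have h1 : c * (d + Real.log (1 / δ)) ≤ N * ε' ^ 2 := by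
      rw [maxSize, div_mul_eq_mul_div, div_le_iff₀ (by positivity)] at hN
      exact hN
    refine le_trans ?_ h1
    gcongr
  have hN0 : 0 < N := by
    rcases Nat.eq_zero_or_pos N with rfl | h0
    · rw [Nat.cast_zero, zero_mul] at hNε; linarith
    · exact h0
  have hl16 : Real.log 16 = 4 * Real.log 2 := by
    rw [show (16 : ℝ) = 2 ^ 4 by norm_num, Real.log_pow]; norm_num
  have hQ : Real.log (16 / δ) = 4 * Real.log 2 + Real.log (1 / δ) := by
    rw [← hl16, ← Real.log_mul (by norm_num) (by positivity), mul_one_div]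
  have hl1 := Real.log_two_gt_d9
  have hl2 := Real.log_two_lt_d9
  -- Q = log(16/δ) turns 8e^(-Q) into δ/2. Since 18432 = 9·2048 and log 16 ≤ 3d, 6d + Q ≤ 9(d +
  -- log(1/δ)).
  refine (measureReal_uniform_dev_le μ (fun i => errorSet f (h i)) hN0 hd1
    (fun z 𝒜 => vcDim_hitSet_le hY f h z 𝒜) hε (Q := Real.log (16 / δ)) (by linarith)
    (by linarith)).trans (le_of_eq ?_)
  rw [← Real.log_inv, Real.exp_log (by positivity), inv_div]
  ring

end Saphyra

/-! ### Assembly of the failure probability -/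

theorem mainTheorem2 :
    ∃ c₀ : ℝ, 0 < c₀ ∧ ∀ c : ℝ, c₀ ≤ c →
    -- the discrete sample space, the two-element label space, the distribution and the hypotheses
    ∀ {X Y : Type*} [Countable X] [MeasurableSpace X] [MeasurableSingletonClass X],
    Nat.card Y = 2 →
    ∀ (D : PMF X) (f : X → Y) (k : ℕ) (h : Fin k → X → Y), (∃ i j, h i ≠ h j) →
    ∀ ε δ : ℝ, 0 < ε → ε < 1 → 0 < δ → δ < 1 →
    -- the exact subspace; its complement, the approximate subspace, has positive weight
    ∀ Xhat : Set X, 0 < Saphyra.mass D Xhatᶜ →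
    -- the output of the procedure for the exact subspace
    ∀ (lamHat : ℝ) (ellHat : Fin k → ℝ), lamHat = Saphyra.mass D Xhat →
    (∀ i, ellHat i = Saphyra.riskOn D f Xhat (h i)) →
    -- independent samples from the renormalized distribution on the approximate subspace
    ∀ {Ω : Type*} [MeasurableSpace Ω] (P : Measure Ω) [IsProbabilityMeasure P]
      (ξ : ℕ → Ω → X), (∀ n, Measurable (ξ n)) → iIndepFun ξ P →
    (∀ n x, P.real (ξ n ⁻¹' {x}) = Saphyra.approxProb D Xhat x) →
    -- the allocated error probabilities, possibly random but independent of the samples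
    ∀ dl : Ω → Fin k → ℝ, Measurable dl → IndepFun dl (fun ω n => ξ n ω) P →
    (∀ ω i, 0 < dl ω i) →
    (∀ ω, ∑ i, 2 * dl ω i =
      δ / (Saphyra.rounds c (ε / (1 - lamHat)) δ (Saphyra.vcDim (Set.range h)) : ℝ)) →
    1 - δ ≤ P.real {ω | ∀ i, |Saphyra.risk D f (h i) -
      Saphyra.estimate c ε δ f h lamHat ellHat (dl ω) (fun n => ξ n ω) i| < ε} := by
  refine ⟨18432, by norm_num, ?_⟩
  intro c hc X Y _ _ _ hY D f k h hne ε δ hε _ hδ hδ1 Xhat hlam lamHat ellHat hlamHat hell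
    Ω _ P _ ξ hξ hind hlaw dl hdl hdlξ hdl0 hdlsum
  have hc0 : 0 < c := by linarith
  have hlam1 : 1 - lamHat = Saphyra.mass D Xhatᶜ := by
    have := Saphyra.mass_add_mass_compl D Xhat
    linarith
  set lam := Saphyra.mass D Xhatᶜ with hlamdef
  rw [hlam1] at hdlsum
  set ε' := ε / lam with hε'
  have hε0 : 0 < ε' := by positivity
  set d := Saphyra.vcDim (Set.range h) with hd
  set R := Saphyra.rounds c ε' δ d with hR
  set N₀ := ⌈Saphyra.initSize c ε' δ⌉₊ with hN₀
  set Nmax := ⌈Saphyra.maxSize c ε' δ d⌉₊ with hNmax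
  have hlog : 0 < Real.log (1 / δ) := Real.log_pos (by rw [lt_div_iff₀ hδ]; linarith)
  have hN₀pos : 0 < N₀ := Nat.ceil_pos.2 (by unfold Saphyra.initSize; positivity)
  have hN₀max : N₀ ≤ Nmax := by
    refine Nat.ceil_mono ?_
    unfold Saphyra.initSize Saphyra.maxSize
    gcongr
    linarith [(Nat.cast_nonneg d : (0 : ℝ) ≤ d)]
  have hdouble : Nmax ≤ 2 ^ R * N₀ := Saphyra.maxSize_le_two_pow_mul hc0 hε0 hδ hδ1 d
  -- the common distribution of the samples
  set μ := P.map (ξ 0) with hμ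
  have hμp : IsProbabilityMeasure μ := Measure.isProbabilityMeasure_map (hξ 0).aemeasurable
  have hsing : ∀ n x, (P.map (ξ n)).real {x} = Saphyra.approxProb D Xhat x := fun n x => by
    rw [map_measureReal_apply (hξ n) (measurableSet_singleton x), hlaw]
  have hlaw' : ∀ n, P.map (ξ n) = μ := fun n => by
    have := Measure.isProbabilityMeasure_map (μ := P) (hξ n).aemeasurable
    refine Measure.ext_of_singleton fun x => ?_
    rw [← ofReal_measureReal, ← ofReal_measureReal, hsing, hsing]
  have hrisk := fun i => Saphyra.risk_eq D f (h i) Xhat hlam μ (hsing 0)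
  -- the levels are small
  obtain ⟨ω₀⟩ : Nonempty Ω := nonempty_of_isProbabilityMeasure P
  -- R = 0 would make the budget δ/R equal to 0, contradicting the positive levels of a nonempty
  -- family.
  have hRpos : 0 < R := by
    rcases Nat.eq_zero_or_pos R with h0 | h0
    · exfalso
      obtain ⟨i, -⟩ := hne
      have h1 := hdlsum ω₀
      rw [h0, Nat.cast_zero, div_zero] at h1
      have h2 := Finset.single_le_sum (fun j _ => (mul_pos two_pos (hdl0 ω₀ j)).le)
        (Finset.mem_univ i)
      have := hdl0 ω₀ i
      linarith
    · exact h0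
  have hR1 : (1 : ℝ) ≤ R := by exact_mod_cast hRpos
  have hdl2 : ∀ ω i, dl ω i < 2 := by
    intro ω i
    have h2 := Finset.single_le_sum (fun j _ => (mul_pos two_pos (hdl0 ω j)).le)
      (Finset.mem_univ i)
    rw [hdlsum ω] at h2
    have : δ / R ≤ 1 := by rw [div_le_one (by linarith)]; linarith
    linarith
  -- the exceptional events
  let size : ℕ → ℕ := fun s => min (2 ^ s * N₀) Nmax
  have hsize : ∀ s, 0 < size s := fun s => lt_min (by positivity) (by omega)
  let E : ℕ → Fin k → Set Ω := fun s i => {ω | Real.exp (-(size s * Saphyra.devRate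
    (Saphyra.hitCount (Saphyra.errorSet f (h i)) (fun j : Fin (size s) => ξ j ω) / size s)
    (μ.real (Saphyra.errorSet f (h i))))) ≤ dl ω i / 2}
  let F : Set Ω := {ω | ∃ i, ε' ≤
    |(Saphyra.hitCount (Saphyra.errorSet f (h i)) (fun j : Fin Nmax => ξ j ω) : ℝ) / Nmax -
      μ.real (Saphyra.errorSet f (h i))|}
  have hE : ∀ s i, P (E s i) ≤ ∫⁻ ω, ENNReal.ofReal (dl ω i) ∂P := fun s i =>
    Saphyra.measure_bernstein_fail_le hξ hind hlaw' _ (hsize s) ((measurable_pi_apply i).comp hdl)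
      (hdlξ.comp (measurable_pi_apply i) measurable_id) fun ω => hdl0 ω i
  have hF : P F ≤ ENNReal.ofReal (δ / 2) := by
    rw [← ofReal_measureReal (μ := P)]
    refine ENNReal.ofReal_le_ofReal ?_
    exact (Saphyra.measureReal_samples hξ hind hlaw' Nmax {x | ∃ i, ε' ≤
      |(Saphyra.hitCount (Saphyra.errorSet f (h i)) x : ℝ) / Nmax -
        μ.real (Saphyra.errorSet f (h i))|}).trans_le
      (Saphyra.measureReal_max_sample_le μ hY f h hne hc hε0 hδ hδ1 (Nat.le_ceil _))
  have hEsum : ∀ s, ∑ i, P (E s i) ≤ ENNReal.ofReal (δ / (2 * R)) := by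
    intro s
    refine (Finset.sum_le_sum fun i _ => hE s i).trans (le_of_eq ?_)
    rw [← lintegral_finsetSum (f := fun i ω => ENNReal.ofReal (dl ω i)) _ fun i _ =>
      ((measurable_pi_apply i).comp hdl).ennreal_ofReal]
    have : ∀ ω, ∑ i, ENNReal.ofReal (dl ω i) = ENNReal.ofReal (δ / (2 * R)) := by
      intro ω
      rw [← ENNReal.ofReal_sum_of_nonneg fun i _ => (hdl0 ω i).le]
      congr 1
      have := hdlsum ω
      rw [← Finset.mul_sum] at this
      rw [mul_comm 2 (R : ℝ), ← div_div, ← this]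
      ring
    simp [this]
  -- every failure of the algorithm is exceptional
  have hcover : {ω | ∀ i, |Saphyra.risk D f (h i) -
      Saphyra.estimate c ε δ f h lamHat ellHat (dl ω) (fun n => ξ n ω) i| < ε}ᶜ ⊆
      (⋃ s ∈ Finset.range R, ⋃ i, E s i) ∪ F := by
    intro ω hω
    simp only [Set.mem_compl_iff, Set.mem_ofPred_eq, not_forall, not_lt] at hω
    obtain ⟨i, hi⟩ := hω
    obtain ⟨s, hs, hloop, hhalt⟩ := Saphyra.loop_spec (fun N => ∀ i,
      Saphyra.bernsteinError N (dl ω i)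
        (Saphyra.sampleVar N fun j => Saphyra.loss (h i (ξ j ω)) (f (ξ j ω))) ≤ ε')
      Nmax R N₀ hN₀max
    have hfin : Saphyra.finalSize c ε δ lam f h (dl ω) (fun n => ξ n ω) = size s := hloop
    have hdev : ε' ≤ |μ.real (Saphyra.errorSet f (h i)) -
        Saphyra.sampleMean (size s) fun j => Saphyra.loss (h i (ξ j ω)) (f (ξ j ω))| := by
      simp only [Saphyra.estimate, hlam1, hfin] at hi
      rw [hrisk, hell, ← hlamdef, add_sub_add_left_eq_sub, ← mul_sub, abs_mul,
        abs_of_pos hlam] at hi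
      rw [hε', div_le_iff₀ hlam]
      linarith
    -- An early stop certifies a Bernstein failure. After all rounds the size is Nmax and the
    -- uniform bound applies.
    rcases hs.lt_or_eq with hsR | rfl
    · refine Or.inl (Set.mem_biUnion (Finset.mem_coe.2 (Finset.mem_range.2 hsR))
        (Set.mem_iUnion.2 ⟨i, ?_⟩))
      exact Saphyra.exp_devRate_le_of_bernstein f (h i) (fun n => ξ n ω) (hsize s) (hdl0 ω i)
        (hdl2 ω i) ((hhalt hsR i).trans hdev)
    · refine Or.inr ⟨i, ?_⟩
      have e : size R = Nmax := min_eq_right hdouble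
      rw [e, Saphyra.sampleMean_loss f (h i) (fun n => ξ n ω), abs_sub_comm] at hdev
      exact hdev
  have hbad : P ({ω | ∀ i, |Saphyra.risk D f (h i) -
      Saphyra.estimate c ε δ f h lamHat ellHat (dl ω) (fun n => ξ n ω) i| < ε}ᶜ) ≤
      ENNReal.ofReal δ := by
    refine (measure_mono hcover).trans ((measure_union_le _ _).trans ?_)
    have h1 : P (⋃ s ∈ Finset.range R, ⋃ i, E s i) ≤ ENNReal.ofReal (δ / 2) := by
      refine (measure_biUnion_finset_le _ _).trans ?_
      refine (Finset.sum_le_sum fun s _ => (measure_iUnion_fintype_le P _).trans (hEsum s)).trans ?_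
      rw [Finset.sum_const, Finset.card_range, nsmul_eq_mul, ← ENNReal.ofReal_natCast,
        ← ENNReal.ofReal_mul (by positivity)]
      refine ENNReal.ofReal_le_ofReal (le_of_eq ?_)
      field_simp
    refine (add_le_add h1 hF).trans (le_of_eq ?_)
    rw [← ENNReal.ofReal_add (by positivity) (by positivity), add_halves]
  set G := {ω | ∀ i, |Saphyra.risk D f (h i) -
      Saphyra.estimate c ε δ f h lamHat ellHat (dl ω) (fun n => ξ n ω) i| < ε} with hG
  have htot : 1 ≤ P.real G + P.real Gᶜ := by
    have := measureReal_union_le (μ := P) G Gᶜ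
    rwa [Set.union_compl_self, probReal_univ] at this
  have hbad' : P.real Gᶜ ≤ δ := ENNReal.toReal_le_of_le_ofReal hδ.le hbad
  linarith
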